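/- Let $d, r \ge 1$ be integers, let $\mathcal X \subset \mathbb R^d$ be bounded, and let $X_1,\dots,X_n$ ($n \ge 1$) be i.i.d. random vectors with probability density $p_0$ on $\mathbb R^d$. Suppose $p_0 \in \mathcal C^r(\mathcal X)$, that is, $p_0$ is $r$ times continuously differentiable near every point of $\mathcal X$ and its partial derivatives up to order $r$ are bounded and integrable on $\mathcal X$. For $R>0$ let $$\widehat f_{n,R}(x) = \frac{1}{n\pi^d}\sum_{k=1}^n \prod_{j=1}^d \frac{\sin(R(x_j - X_{kj}))}{x_j - X_{kj}}$$ (a factor with $x_j = X_{kj}$ is read as its limit $R$). Let $\nabla^i f(x)$ be the tensor of all partial derivatives of order $i$, let $\|\cdot\|_{\max}$ be the largest absolute value of an entry, and let $\widehat{p_0}(s)=\int_{\mathbb R^d} e^{-i\langle s,t\rangle}p_0(t)\,dt$. Fix $K>0$. (a) Suppose that $p_0$ is upper-supersmooth of order $\alpha>0$, i.e. $|\widehat{p_0}(s)| \le A\exp(-C_1\sum_{j}|s_j|^\alpha)$ for all $s\in\mathbb R^d$, where $A, C_1>0$. Then there are constants $C>0$ and $C'\ge 1$, depending only on $d$, $r$,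 $\alpha$, $A$, $C_1$, $K$ and an upper bound for the diameter of $\mathcal X$, such that for all $R\ge C'$, $1\le i\le r$, $\delta\in(0,1)$ and $n \ge 1$ with $R^d\log R\,\log(2/\delta)\le K n$, $$\mathbb P\left(\sup_{x\in\mathcal X}\left\|\nabla^i\widehat f_{n,R}(x)-\nabla^i p_0(x)\right\|_{\max} \ge C\left(R^{\max\{1+i-\alpha,0\}}e^{-C_1R^\alpha}+\sqrt{\frac{R^{d+2i}\log R\,\log(2/\delta)}{n}}\right)\right)\le\delta .$$ (b) Suppose that $p_0$ is upper-ordinary smooth of order $\beta>r+1$, i.e. $|\widehat{p_0}(s)| \le A\prod_{j}\frac{1}{1+|s_j|^\beta}$ for all $s\in\mathbb R^d$, where $A>0$. Then there is a constant $c>0$, depending only on $d$, $r$, $\beta$, $A$, $K$ and an upper bound for the diameter of $\mathcal X$, such that for all $R\ge 1$, $1\le i\le r$, $\delta\in(0,1)$ and $n \ge 1$ with $R^d\log R\,\log(2/\delta)\le K n$, $$\mathbb P\left(\sup_{x\in\mathcal X}\left\|\nabla^i\widehat f_{n,R}(x)-\nabla^i p_0(x)\right\|_{\max} \ge c\left(R^{-\beta+i+1}+\sqrt{\frac{R^{d+2i}\log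 R\,\log(2/\delta)}{n}}\right)\right)\le\delta .$$ -/

import Mathlib

open MeasureTheory ProbabilityTheory

noncomputable section

/-- The Fourier transform on `ℝ^d` with angular frequencies (no factor `2π` in the exponent):
`p̂(s) = ∫ e^{-i⟨s,t⟩} p(t) dt`. -/
def angularFourier {d : ℕ} (p : EuclideanSpace ℝ (Fin d) → ℝ) (s : EuclideanSpace ℝ (Fin d)) : ℂ :=
  ∫ t, Complex.exp (-(Complex.I * ((inner ℝ s t : ℝ) : ℂ))) * ((p t : ℝ) : ℂ)

/-- `p` is a probability density with respect to Lebesgue measure on `ℝ^d`. -/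
def IsProbDensity {d : ℕ} (p : EuclideanSpace ℝ (Fin d) → ℝ) : Prop :=
  (∀ x, 0 ≤ p x) ∧ Integrable p ∧ ∫ x, p x = 1

/-- `p` is upper-supersmooth of order `α`, with multiplicative constant `A` and exponential
constant `C₁`. -/
def IsUpperSupersmooth {d : ℕ} (α A C₁ : ℝ) (p : EuclideanSpace ℝ (Fin d) → ℝ) : Prop :=
  ∀ s, ‖angularFourier p s‖ ≤ A * Real.exp (-C₁ * ∑ j, |s j| ^ α)

/-- `p` is upper-ordinary smooth of order `β`, with constant `A`. -/
def IsUpperOrdinarySmooth {d : ℕ} (β A : ℝ) (p : EuclideanSpace ℝ (Fin d) → ℝ) : Prop :=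
  ∀ s, ‖angularFourier p s‖ ≤ A * ∏ j, 1 / (1 + |s j| ^ β)

/-- The tensor `∇^i f (x)` of all partial derivatives of order `i`:
its entry at `(u₁, …, u_i)` is `∂_{u₁} ⋯ ∂_{u_i} f (x)`.
The norm of the type `(Fin i → Fin d) → ℝ` is the maximum of the absolute values of the entries. -/
def gradTensor {d : ℕ} (i : ℕ) (f : EuclideanSpace ℝ (Fin d) → ℝ) (x : EuclideanSpace ℝ (Fin d)) :
    (Fin i → Fin d) → ℝ :=
  fun u => iteratedFDeriv ℝ i f x (fun k => EuclideanSpace.single (u k) (1 : ℝ))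

/-- The class `C^r(S)`: near every point of `S` the function is `r` times continuously
differentiable, and its partial derivatives up to order `r` are bounded and integrable on `S`. -/
def MemCr {d : ℕ} (r : ℕ) (S : Set (EuclideanSpace ℝ (Fin d)))
    (p : EuclideanSpace ℝ (Fin d) → ℝ) : Prop :=
  (∀ x ∈ S, ContDiffAt ℝ r p x) ∧
    ∀ j ≤ r, ∀ u : Fin j → Fin d,
      (∃ B : ℝ, ∀ x ∈ S, |gradTensor j p x u| ≤ B) ∧ IntegrableOn (fun x => gradTensor j p x u) S

/-- The univariate Fourier kernel `sin (R u) / u`, with its continuous value `R` at `u = 0`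
(`Real.sinc v` is `sin v / v`, and `1` at `v = 0`). -/
def fourierKernel (R u : ℝ) : ℝ := R * Real.sinc (R * u)

/-- The Fourier density estimator
`(1 / (n π^d)) ∑_k ∏_j sin (R (x_j - X_{kj})) / (x_j - X_{kj})` of a sample `X_1, …, X_n`. -/
def fourierEstimator {d n : ℕ} (R : ℝ) (X : Fin n → EuclideanSpace ℝ (Fin d))
    (x : EuclideanSpace ℝ (Fin d)) : ℝ :=
  1 / ((n : ℝ) * Real.pi ^ d) * ∑ k, ∏ j, fourierKernel R (x j - X k j)

/-- `X_1, …, X_n` are independent random vectors, each with density `p`. -/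
def IsIIDSample {d n : ℕ} {Ω : Type*} [MeasurableSpace Ω] (P : Measure Ω)
    (p : EuclideanSpace ℝ (Fin d) → ℝ) (X : Fin n → Ω → EuclideanSpace ℝ (Fin d)) : Prop :=
  (∀ k, Measurable (X k)) ∧ iIndepFun X P ∧
    ∀ k, P.map (X k) = volume.withDensity (fun x => ENNReal.ofReal (p x))

/-- `sup_{x ∈ S} ‖∇^i f (x) - ∇^i p (x)‖_max`, with values in `[0, ∞]`. -/
def supGradError {d : ℕ} (i : ℕ) (S : Set (EuclideanSpace ℝ (Fin d)))
    (f p : EuclideanSpace ℝ (Fin d) → ℝ) : ENNReal :=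
  ⨆ x ∈ S, ‖gradTensor i f x - gradTensor i p x‖ₑ

end

/-! Up to a factor, the kernel `sin (R u) / u` is the Fourier transform of the indicator of `[-R,
R]`. The estimator is therefore the Fourier inverse of the empirical characteristic function cut off
to the cube `[-R, R]^d` (`ofReal_fourierEstimator`). The smoothness hypotheses make `‖s‖ ^ k *
‖angularFourier p s‖` integrable for `k ≤ r`, so near points of `S` the density is the Fourier
inverse of its characteristic function, and both integrals can be differentiated under the integral
sign (`gradTensor_eq_synthesis`). The error then splits into a deterministic integral outside the
cube and a random one over it (`abs_gradTensor_sub_le`).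

Bias. Outside the cube some coordinate exceeds `R`. Since the envelope is a product, the integral
factors into one tail and `d - 1` moments in dimension one (`integral_compl_centeredCube_le`).

Fluctuation at a point. It is an average of bounded i.i.d. terms. Expanding the square and applying
Fubini bounds their second moment by a multiple of `R ^ (2 * i + d)` times the `L¹` norm of the
characteristic function, which saves a factor `R ^ d` over the square of the sup bound
(`integral_sq_norm_kernelTerm_mul_le`). A Chernoff bound follows; the hypothesis `R ^ d * log R *
log (2 / δ) ≤ K * n` is what keeps its parameter admissible.

Uniformity. The fluctuation is band-limited, hence equal to its Taylor series everywhere. If at a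
point all its further derivatives of order `k` are at most `R ^ k * (k + 1) * T`, then it is at most
`T * exp (2 * d)` throughout the surrounding cube of half-width `1 / R` (`abs_fluctuation_add_le`).
A union bound runs over a net of `O(R ^ d)` points, all orders `k` and all directions. The factor `k
+ 1` makes the failure probabilities geometric in `k`, and the factorials in the Taylor series
absorb it. -/

noncomputable section

/-! ### Plane waves, monomials and differentiation under the integral. -/

/-- The plane wave `e^{i⟨s,x⟩}`. -/
def planeWave {d : ℕ} (s x : EuclideanSpace ℝ (Fin d)) : ℂ :=
  Complex.exp (Complex.I * ((inner ℝ s x : ℝ) : ℂ))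

/-- The monomial `s_{u₁} ⋯ s_{u_m}`. -/
def coordMonomial {d m : ℕ} (u : Fin m → Fin d) (s : EuclideanSpace ℝ (Fin d)) : ℝ :=
  ∏ l, s (u l)

/-- The function with spectral density `ψ` relative to `μ`, differentiated in the directions
`u₁, …, u_m`. -/
def synthesis {d m : ℕ} (μ : Measure (EuclideanSpace ℝ (Fin d)))
    (ψ : EuclideanSpace ℝ (Fin d) → ℂ) (u : Fin m → Fin d) (x : EuclideanSpace ℝ (Fin d)) : ℂ :=
  ∫ s, Complex.I ^ m * (coordMonomial u s : ℂ) * planeWave s x * ψ s ∂μ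

/-- The cube `[-R, R]^d`. -/
def centeredCube (d : ℕ) (R : ℝ) : Set (EuclideanSpace ℝ (Fin d)) :=
  {s | ∀ j, |s j| ≤ R}

variable {d m n : ℕ}

lemma norm_planeWave (s x : EuclideanSpace ℝ (Fin d)) : ‖planeWave s x‖ = 1 := by
  rw [planeWave, mul_comm, Complex.norm_exp_ofReal_mul_I]

lemma planeWave_add (s x y : EuclideanSpace ℝ (Fin d)) :
    planeWave s (x + y) = planeWave s x * planeWave s y := by
  simp only [planeWave, inner_add_right, ← Complex.exp_add]
  push_cast; ring_nf

lemma continuous_planeWave : Continuous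
    (fun z : EuclideanSpace ℝ (Fin d) × EuclideanSpace ℝ (Fin d) => planeWave z.1 z.2) := by
  unfold planeWave; fun_prop

@[fun_prop]
lemma continuous_planeWave_left (x : EuclideanSpace ℝ (Fin d)) :
    Continuous fun s => planeWave s x := by
  unfold planeWave; fun_prop

@[fun_prop]
lemma continuous_coordMonomial (u : Fin m → Fin d) : Continuous (coordMonomial u) := by
  unfold coordMonomial; fun_prop

lemma abs_coordMonomial_le_norm (u : Fin m → Fin d) (s : EuclideanSpace ℝ (Fin d)) :
    |coordMonomial u s| ≤ ‖s‖ ^ m := by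
  rw [coordMonomial, Finset.abs_prod]
  calc ∏ l, |s (u l)| ≤ ∏ _l : Fin m, ‖s‖ :=
        Finset.prod_le_prod (fun _ _ => abs_nonneg _) fun l _ => PiLp.norm_apply_le s (u l)
    _ = ‖s‖ ^ m := by simp

lemma abs_coordMonomial_le_pow {R : ℝ} (u : Fin m → Fin d) {s : EuclideanSpace ℝ (Fin d)}
    (hs : s ∈ centeredCube d R) : |coordMonomial u s| ≤ R ^ m := by
  rw [coordMonomial, Finset.abs_prod]
  calc ∏ l, |s (u l)| ≤ ∏ _l : Fin m, R :=
        Finset.prod_le_prod (fun _ _ => abs_nonneg _) fun l _ => hs (u l)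
    _ = R ^ m := by simp

/-- Differentiation under the integral sign for functions with a spectral density. -/
lemma gradTensor_eq_synthesis {μ : Measure (EuclideanSpace ℝ (Fin d))}
    {ψ : EuclideanSpace ℝ (Fin d) → ℂ} {i : ℕ}
    (hψ : ∀ k ≤ i, Integrable (fun s => ‖s‖ ^ k * ‖ψ s‖) μ) (hm : AEStronglyMeasurable ψ μ)
    {f : EuclideanSpace ℝ (Fin d) → ℝ} {x : EuclideanSpace ℝ (Fin d)}
    (hf : ∀ᶠ y in nhds x, (f y : ℂ) = ∫ s, planeWave s y * ψ s ∂μ) (u : Fin i → Fin d) :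
    (gradTensor i f x u : ℂ) = synthesis μ ψ u x := by
  -- This scaling turns the character `e^{-2πi L(s, x)}` into `e^{i⟨s, x⟩}`.
  set L : EuclideanSpace ℝ (Fin d) →L[ℝ] EuclideanSpace ℝ (Fin d) →L[ℝ] ℝ :=
    (-(2 * Real.pi)⁻¹ : ℝ) • innerSL ℝ with hL
  have hpi : (Real.pi : ℂ) ≠ 0 := by exact_mod_cast Real.pi_ne_zero
  have hLa : ∀ v w, L v w = -(2 * Real.pi)⁻¹ * inner ℝ v w := fun v w => by
    simp only [hL, smul_apply, smul_eq_mul]; rfl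
  have hchar : ∀ v w, ((Real.fourierChar (-L v w) : Circle) : ℂ) = planeWave v w := fun v w => by
    rw [Real.fourierChar_apply, planeWave, hLa]
    congr 1
    push_cast
    field_simp
  have hfun : (fun y => (f y : ℂ)) =ᶠ[nhds x]
      VectorFourier.fourierIntegral Real.fourierChar μ L.toLinearMap₁₂ ψ := by
    filter_upwards [hf] with y hy
    rw [hy, VectorFourier.fourierIntegral]
    refine integral_congr_ae (.of_forall fun s => ?_)
    simp only [Circle.smul_def, smul_eq_mul]
    rw [← hchar]; rfl
  -- Smoothness of `f` is read off from the real part of the transform; it is needed to commute the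
  -- derivative with the inclusion of `ℝ` in `ℂ`.
  have hc : ContDiffAt ℝ i f x := by
    have h0 : ContDiff ℝ ((i : ℕ∞) : WithTop ℕ∞)
        (VectorFourier.fourierIntegral Real.fourierChar μ L.toLinearMap₁₂ ψ) :=
      VectorFourier.contDiff_fourierIntegral L fun k hk => hψ k (by exact_mod_cast hk)
    refine (Complex.reCLM.contDiff.comp h0).contDiffAt.congr_of_eventuallyEq ?_
    filter_upwards [hfun] with y hy
    simp [← hy]
  have h1 : iteratedFDeriv ℝ i (fun y => (f y : ℂ)) x =
      VectorFourier.fourierIntegral Real.fourierChar μ L.toLinearMap₁₂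
        (fun v => VectorFourier.fourierPowSMulRight L ψ v i) x := by
    rw [(hfun.iteratedFDeriv ℝ i).eq_of_nhds,
      VectorFourier.iteratedFDeriv_fourierIntegral (N := (i : ℕ∞)) L
        (fun k hk => hψ k (by exact_mod_cast hk)) hm le_rfl]
  have h2 : iteratedFDeriv ℝ i (fun y => (f y : ℂ)) x =
      Complex.ofRealCLM.compContinuousMultilinearMap (iteratedFDeriv ℝ i f x) :=
    Complex.ofRealCLM.iteratedFDeriv_comp_left hc le_rfl
  have h3 := congrArg (fun T => T (fun k => EuclideanSpace.single (u k) (1 : ℝ))) (h2.symm.trans h1)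
  simp only [ContinuousLinearMap.compContinuousMultilinearMap_coe, Function.comp_apply,
    Complex.ofRealCLM_apply] at h3
  rw [gradTensor, h3, Real.fourierIntegral_continuousMultilinearMap_apply'
    (VectorFourier.integrable_fourierPowSMulRight L (hψ i le_rfl) hm), VectorFourier.fourierIntegral,
    synthesis]
  refine integral_congr_ae (.of_forall fun s => ?_)
  have hpt : ∀ c : ℂ, Real.fourierChar (-(L.toLinearMap₁₂ s x)) • c = planeWave s x * c :=
    fun c => by rw [← hchar]; rfl
  refine (hpt _).trans ?_
  rw [VectorFourier.fourierPowSMulRight_apply]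
  simp only [hLa, coordMonomial, EuclideanSpace.inner_single_right, Finset.prod_mul_distrib,
    Finset.prod_const, Finset.card_univ, Fintype.card_fin, Complex.real_smul, smul_eq_mul]
  have : (-(2 * (Real.pi : ℂ) * Complex.I)) ^ i * (-(2 * (Real.pi : ℂ))⁻¹) ^ i = Complex.I ^ i := by
    rw [← mul_pow]; congr 1; field_simp
  push_cast
  rw [← this]
  simp
  ring

/-! ### Fourier inversion and the splitting of the error. -/

/-- The normalization `(2π)^{-d}` of Fourier inversion in angular frequencies. -/
def inversionConst (d : ℕ) : ℝ := ((2 * Real.pi) ^ d)⁻¹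

lemma inversionConst_pos (d : ℕ) : 0 < inversionConst d := by
  unfold inversionConst; positivity

/-- The empirical characteristic function (with the sign of the Fourier transform). -/
def empiricalFourier (X : Fin n → EuclideanSpace ℝ (Fin d)) (s : EuclideanSpace ℝ (Fin d)) : ℂ :=
  (n : ℂ)⁻¹ * ∑ k, planeWave s (-X k)

lemma integral_euclidean_prod {𝕜 : Type*} [RCLike 𝕜] (f : Fin d → ℝ → 𝕜) :
    ∫ s : EuclideanSpace ℝ (Fin d), ∏ j, f j (s j) = ∏ j, ∫ t, f j t := by
  rw [← integral_fintype_prod_volume_eq_prod]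
  exact (PiLp.volume_preserving_ofLp (Fin d)).integral_comp
    (MeasurableEquiv.toLp 2 (Fin d → ℝ)).symm.measurableEmbedding (fun v => ∏ j, f j (v j))

lemma integrable_euclidean_prod {𝕜 : Type*} [RCLike 𝕜] {f : Fin d → ℝ → 𝕜}
    (hf : ∀ j, Integrable (f j)) :
    Integrable fun s : EuclideanSpace ℝ (Fin d) => ∏ j, f j (s j) :=
  ((PiLp.volume_preserving_ofLp (Fin d)).integrable_comp_emb
    (MeasurableEquiv.toLp 2 (Fin d → ℝ)).symm.measurableEmbedding).2 (Integrable.fintype_prod hf)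

lemma measurableSet_centeredCube (d : ℕ) (R : ℝ) : MeasurableSet (centeredCube d R) := by
  have : centeredCube d R = ⋂ j : Fin d, {s | |s j| ≤ R} := by ext; simp [centeredCube]
  rw [this]
  exact MeasurableSet.iInter fun j => measurableSet_le (by fun_prop) measurable_const

lemma indicator_centeredCube_prod {𝕜 : Type*} [RCLike 𝕜] (R : ℝ) (f : Fin d → ℝ → 𝕜)
    (s : EuclideanSpace ℝ (Fin d)) :
    (centeredCube d R).indicator (fun s => ∏ j, f j (s j)) s =
      ∏ j, (Set.Icc (-R) R).indicator (f j) (s j) := by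
  by_cases hs : s ∈ centeredCube d R
  · rw [Set.indicator_of_mem hs]
    exact Finset.prod_congr rfl fun j _ => (Set.indicator_of_mem
      (show s j ∈ Set.Icc (-R) R from abs_le.1 (hs j)) _).symm
  · rw [Set.indicator_of_notMem hs]
    simp only [centeredCube, Set.mem_ofPred_eq, not_forall] at hs
    obtain ⟨j, hj⟩ := hs
    exact (Finset.prod_eq_zero (Finset.mem_univ j)
      (Set.indicator_of_notMem (fun h : s j ∈ Set.Icc (-R) R => hj (abs_le.2 h)) _)).symm

lemma integral_centeredCube_prod {𝕜 : Type*} [RCLike 𝕜] (R : ℝ) (f : Fin d → ℝ → 𝕜) :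
    ∫ s in centeredCube d R, ∏ j, f j (s j) = ∏ j, ∫ t in Set.Icc (-R) R, f j t := by
  rw [← integral_indicator (measurableSet_centeredCube d R)]
  simp only [indicator_centeredCube_prod, integral_euclidean_prod,
    integral_indicator measurableSet_Icc]

lemma volume_real_centeredCube {R : ℝ} (hR : 0 ≤ R) :
    volume.real (centeredCube d R) = (2 * R) ^ d := by
  have h := integral_centeredCube_prod (d := d) (𝕜 := ℝ) R (fun _ _ => 1)
  simp only [Finset.prod_const_one, setIntegral_const, smul_eq_mul, mul_one, Finset.prod_const,
    Finset.card_univ, Fintype.card_fin, Real.volume_real_Icc_of_le (neg_le_self hR)] at h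
  rw [h]; ring

lemma isCompact_centeredCube (d : ℕ) (R : ℝ) : IsCompact (centeredCube d R) := by
  have h : IsCompact (Set.univ.pi fun _ : Fin d => Set.Icc (-R) R) :=
    isCompact_univ_pi fun _ => isCompact_Icc
  have := h.image (PiLp.continuous_toLp 2 (fun _ : Fin d => ℝ))
  convert this using 1
  ext s
  simp only [centeredCube, Set.mem_ofPred_eq, Set.mem_image, Set.mem_pi, Set.mem_univ, true_imp_iff,
    abs_le, Set.mem_Icc]
  exact ⟨fun h => ⟨_, h, rfl⟩, by rintro ⟨v, hv, rfl⟩; exact hv⟩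

instance isFiniteMeasure_restrict_centeredCube (d : ℕ) (R : ℝ) :
    IsFiniteMeasure ((volume : Measure (EuclideanSpace ℝ (Fin d))).restrict (centeredCube d R)) :=
  ⟨by simpa using (isCompact_centeredCube d R).measure_lt_top⟩

/-- Integrating `e^{itu}` over `[-R, R]` gives `2 sin (R u) / u`; the value at `u = 0` is separate
because the antiderivative divides by `u`. -/
lemma ofReal_fourierKernel {R : ℝ} (hR : 0 < R) (u : ℝ) :
    (fourierKernel R u : ℂ) =
      2⁻¹ * ∫ t in Set.Icc (-R) R, Complex.exp (Complex.I * ((t * u : ℝ) : ℂ)) := by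
  rw [integral_Icc_eq_integral_Ioc, ← intervalIntegral.integral_of_le (by linarith), fourierKernel]
  rcases eq_or_ne u 0 with rfl | hu
  · simp
    ring
  · have hu' : (u : ℂ) ≠ 0 := by exact_mod_cast hu
    have hR' : (R : ℂ) ≠ 0 := by exact_mod_cast hR.ne'
    have : ∀ t : ℝ, Complex.exp (Complex.I * ((t * u : ℝ) : ℂ)) =
        Complex.exp (Complex.I * u * t) := fun t => by push_cast; ring_nf
    simp only [this]
    rw [integral_exp_mul_complex (mul_ne_zero Complex.I_ne_zero hu'),
      Real.sinc_of_ne_zero (mul_ne_zero hR.ne' hu)]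
    push_cast
    rw [Complex.sin]
    have hI := Complex.I_sq
    field_simp
    ring_nf
    simp only [Complex.I_sq]
    ring

/-- The product of the one-dimensional integrals is an integral over the cube; the factors `2⁻¹` of
the coordinates combine with `π^{-d}` into `(2π)^{-d}`. -/
lemma ofReal_fourierEstimator {R : ℝ} (hR : 0 < R) (X : Fin n → EuclideanSpace ℝ (Fin d))
    (x : EuclideanSpace ℝ (Fin d)) :
    (fourierEstimator R X x : ℂ) =
      ∫ s in centeredCube d R, planeWave s x * (inversionConst d * empiricalFourier X s) := by
  have hpi : (Real.pi : ℂ) ≠ 0 := by exact_mod_cast Real.pi_ne_zero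
  have hk : ∀ k, ∫ s in centeredCube d R, planeWave s (x - X k) =
      2 ^ d * ∏ j, (fourierKernel R (x j - X k j) : ℂ) := fun k => by
    have : ∀ s, planeWave s (x - X k) =
        ∏ j, Complex.exp (Complex.I * ((s j * (x j - X k j) : ℝ) : ℂ)) := fun s => by
      rw [← Complex.exp_sum, planeWave, ← Finset.mul_sum, PiLp.inner_apply]
      simp [mul_comm]
    simp only [this, integral_centeredCube_prod R
      (fun j t => Complex.exp (Complex.I * ((t * (x j - X k j) : ℝ) : ℂ))),
      ofReal_fourierKernel hR, Finset.prod_mul_distrib, Finset.prod_const, Finset.card_univ,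
      Fintype.card_fin]
    rw [← mul_assoc, ← mul_pow]
    simp
  have : ∀ s, planeWave s x * (inversionConst d * empiricalFourier X s) =
      ∑ k, (inversionConst d * (n : ℂ)⁻¹) * planeWave s (x - X k) := fun s => by
    simp only [sub_eq_add_neg, planeWave_add, empiricalFourier, ← Finset.mul_sum]
    ring
  simp only [this]
  rw [integral_finsetSum]
  · simp only [integral_const_mul, hk, fourierEstimator, inversionConst, ← Finset.mul_sum]
    push_cast
    rw [mul_pow]
    field_simp
  · exact fun k _ => ((continuous_planeWave_left _).continuousOn.integrableOn_compact
      (isCompact_centeredCube d R)).const_mul _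

lemma angularFourier_eq_planeWave (p : EuclideanSpace ℝ (Fin d) → ℝ)
    (s : EuclideanSpace ℝ (Fin d)) :
    angularFourier p s = ∫ t, planeWave s (-t) * p t := by
  simp [angularFourier, planeWave]

open FourierTransform in
/-- Fourier inversion in angular frequencies, at a point of continuity. -/
lemma ofReal_eq_integral_angularFourier {p : EuclideanSpace ℝ (Fin d) → ℝ} (hp : Integrable p)
    (hF : Integrable (angularFourier p)) {x : EuclideanSpace ℝ (Fin d)} (hx : ContinuousAt p x) :
    (p x : ℂ) = ∫ s, planeWave s x * (inversionConst d * angularFourier p s) := by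
  have hpi := Real.pi_pos
  set g : EuclideanSpace ℝ (Fin d) → ℂ := fun t => (p t : ℂ)
  have hg : ∀ w, 𝓕 g w = angularFourier p ((2 * Real.pi) • w) := fun w => by
    rw [Real.fourier_eq', angularFourier]
    refine integral_congr_ae (.of_forall fun t => ?_)
    simp only [smul_eq_mul, inner_smul_left, g]
    rw [real_inner_comm]
    congr 2
    push_cast
    simp
    ring
  have hgi : Integrable (𝓕 g) := by
    have : 𝓕 g = fun w => angularFourier p ((2 * Real.pi) • w) := funext hg
    rw [this]
    exact hF.comp_smul (by positivity)
  have h := Integrable.fourierInv_fourier_eq (f := g) hp.ofReal hgi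
    (Complex.continuous_ofReal.continuousAt.comp hx)
  rw [← show g x = p x from rfl, ← h, Real.fourierInv_eq']
  -- The substitution `s = 2πw` passes to angular frequencies, and its Jacobian is cancelled by
  -- `inversionConst`.
  have h2 := Measure.integral_comp_smul (volume : Measure (EuclideanSpace ℝ (Fin d)))
    (fun s => planeWave s x * (inversionConst d * angularFourier p s)) (2 * Real.pi)
  have h3 : ∫ s, planeWave s x * (inversionConst d * angularFourier p s) = ((2 * Real.pi) ^ d : ℝ) •
      ∫ w : EuclideanSpace ℝ (Fin d), planeWave ((2 * Real.pi) • w) x *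
        (inversionConst d * angularFourier p ((2 * Real.pi) • w)) := by
    rw [h2, smul_smul]
    simp only [finrank_euclideanSpace, Fintype.card_fin]
    rw [abs_of_pos (by positivity), mul_inv_cancel₀ (by positivity), one_smul]
  rw [h3, ← integral_smul]
  refine integral_congr_ae (.of_forall fun w => ?_)
  simp only [hg, smul_eq_mul, planeWave, inner_smul_left, inversionConst, Complex.real_smul]
  push_cast
  field_simp
  simp
  ring_nf

/-- The real part of the stochastic error of the estimator, differentiated in the directions `u`. -/
def fluctuation (R : ℝ) (X : Fin n → EuclideanSpace ℝ (Fin d)) (p : EuclideanSpace ℝ (Fin d) → ℝ)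
    (u : Fin m → Fin d) (x : EuclideanSpace ℝ (Fin d)) : ℝ :=
  (synthesis (volume.restrict (centeredCube d R))
    (fun s => inversionConst d * (empiricalFourier X s - angularFourier p s)) u x).re

lemma norm_angularFourier_le {p : EuclideanSpace ℝ (Fin d) → ℝ} (hp : IsProbDensity p)
    (s : EuclideanSpace ℝ (Fin d)) : ‖angularFourier p s‖ ≤ 1 := by
  rw [angularFourier_eq_planeWave, ← hp.2.2]
  refine (norm_integral_le_integral_norm _).trans (le_of_eq ?_)
  refine integral_congr_ae (.of_forall fun t => ?_)
  simp [norm_planeWave, abs_of_nonneg (hp.1 t)]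

lemma continuous_angularFourier {p : EuclideanSpace ℝ (Fin d) → ℝ} (hp : Integrable p) :
    Continuous (angularFourier p) := by
  rw [show angularFourier p = fun s => ∫ t, planeWave s (-t) * p t from
    funext (angularFourier_eq_planeWave p)]
  refine continuous_of_dominated (bound := fun t => ‖p t‖) (fun s => ?_) (fun s => ?_) hp.norm ?_
  · refine (Continuous.aestronglyMeasurable ?_).mul
      (Complex.continuous_ofReal.comp_aestronglyMeasurable hp.1)
    unfold planeWave; fun_prop
  · exact .of_forall fun t => by simp [norm_planeWave]
  · exact .of_forall fun t => (continuous_planeWave_left _).mul continuous_const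

@[fun_prop]
lemma continuous_empiricalFourier (X : Fin n → EuclideanSpace ℝ (Fin d)) :
    Continuous (empiricalFourier X) := by
  unfold empiricalFourier; fun_prop

lemma norm_empiricalFourier_le (X : Fin n → EuclideanSpace ℝ (Fin d))
    (s : EuclideanSpace ℝ (Fin d)) : ‖empiricalFourier X s‖ ≤ 1 := by
  rw [empiricalFourier, norm_mul, norm_inv, Complex.norm_natCast]
  rcases Nat.eq_zero_or_pos n with rfl | hn
  · simp
  · rw [inv_mul_le_iff₀ (by exact_mod_cast hn), mul_one]
    refine (norm_sum_le _ _).trans ?_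
    simp [norm_planeWave]

/-- The pointwise error is at most the fluctuation plus the spectral mass outside the cube. -/
lemma abs_gradTensor_sub_le {R : ℝ} (hR : 0 < R) (X : Fin n → EuclideanSpace ℝ (Fin d))
    {p : EuclideanSpace ℝ (Fin d) → ℝ} (hp : Integrable p) {i : ℕ}
    (hF : ∀ k ≤ i, Integrable fun s => ‖s‖ ^ k * ‖angularFourier p s‖)
    {x : EuclideanSpace ℝ (Fin d)} (hx : ∀ᶠ y in nhds x, ContinuousAt p y) (u : Fin i → Fin d) :
    |gradTensor i (fourierEstimator R X) x u - gradTensor i p x u| ≤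
      |fluctuation R X p u x| +
        inversionConst d * ∫ s in (centeredCube d R)ᶜ, |coordMonomial u s| * ‖angularFourier p s‖ := by
  set Q := centeredCube d R
  set c := inversionConst d with hc
  have hc0 : 0 < c := inversionConst_pos d
  set F := angularFourier p
  have hFc : Continuous F := continuous_angularFourier hp
  have hFi : Integrable F := by
    have := hF 0 (Nat.zero_le _)
    simp only [pow_zero, one_mul] at this
    exact (integrable_norm_iff hFc.aestronglyMeasurable).1 this
  have e1 : (gradTensor i (fourierEstimator R X) x u : ℂ) =
      synthesis (volume.restrict Q) (fun s => c * empiricalFourier X s) u x := by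
    refine gradTensor_eq_synthesis (fun k _ => ?_) (by fun_prop)
      (.of_forall fun y => ofReal_fourierEstimator hR X y) u
    exact (Continuous.continuousOn (by fun_prop)).integrableOn_compact (isCompact_centeredCube d R)
  have e2 : (gradTensor i p x u : ℂ) = synthesis volume (fun s => c * F s) u x := by
    refine gradTensor_eq_synthesis (fun k hk => ?_)
      (continuous_const.mul hFc).aestronglyMeasurable
      (hx.mono fun y hy => ofReal_eq_integral_angularFourier hp hFi hy) u
    refine ((hF k hk).const_mul c).congr (.of_forall fun s => ?_)
    change c * (‖s‖ ^ k * ‖F s‖) = ‖s‖ ^ k * ‖(c : ℂ) * F s‖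
    rw [norm_mul, Complex.norm_real, Real.norm_eq_abs, abs_of_pos hc0]
    ring
  have hint : Integrable fun s => Complex.I ^ i * (coordMonomial u s : ℂ) * planeWave s x *
      (c * F s) := by
    refine ((hF i le_rfl).const_mul c).mono' (by fun_prop) (.of_forall fun s => ?_)
    simp only [norm_mul, norm_pow, Complex.norm_I, one_pow, one_mul, norm_planeWave, mul_one,
      Complex.norm_real, Real.norm_eq_abs, abs_of_pos hc0]
    calc |coordMonomial u s| * (c * ‖F s‖) ≤ ‖s‖ ^ i * (c * ‖F s‖) := by
          gcongr; exact abs_coordMonomial_le_norm u s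
      _ = _ := by ring
  have hint' : IntegrableOn (fun s => Complex.I ^ i * (coordMonomial u s : ℂ) * planeWave s x *
      (c * empiricalFourier X s)) Q :=
    (Continuous.continuousOn (by fun_prop)).integrableOn_compact (isCompact_centeredCube d R)
  have e3 : synthesis (volume.restrict Q) (fun s => c * empiricalFourier X s) u x -
      synthesis volume (fun s => c * F s) u x =
      synthesis (volume.restrict Q) (fun s => c * (empiricalFourier X s - F s)) u x -
        synthesis (volume.restrict Qᶜ) (fun s => c * F s) u x := by
    have h1 := integral_add_compl (measurableSet_centeredCube d R) hint
    have h2 : synthesis (volume.restrict Q) (fun s => c * (empiricalFourier X s - F s)) u x =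
        synthesis (volume.restrict Q) (fun s => c * empiricalFourier X s) u x -
        synthesis (volume.restrict Q) (fun s => c * F s) u x := by
      rw [synthesis, synthesis, synthesis, ← integral_sub hint' hint.integrableOn]
      refine integral_congr_ae (.of_forall fun s => ?_)
      simp only
      ring
    rw [h2, sub_sub, sub_right_inj]
    exact h1.symm
  have e4 : gradTensor i (fourierEstimator R X) x u - gradTensor i p x u =
      fluctuation R X p u x - (synthesis (volume.restrict Qᶜ) (fun s => c * F s) u x).re := by
    rw [fluctuation, ← Complex.sub_re, ← e3, ← e1, ← e2]
    simp
  rw [e4]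
  refine (abs_sub _ _).trans (add_le_add_right ((Complex.abs_re_le_norm _).trans ?_) _)
  rw [← integral_const_mul]
  refine (norm_integral_le_integral_norm _).trans (le_of_eq ?_)
  refine integral_congr_ae (.of_forall fun s => ?_)
  simp only [norm_mul, norm_pow, Complex.norm_I, one_pow, one_mul, norm_planeWave, mul_one,
      Complex.norm_real, Real.norm_eq_abs, abs_of_pos hc0]
  ring

/-! ### Spectral mass under a product envelope. -/

/-- The number of occurrences of the coordinate `j` in `u`. -/
def coordCount (u : Fin m → Fin d) (j : Fin d) : ℕ := (Finset.univ.filter fun l => u l = j).card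

lemma coordCount_le (u : Fin m → Fin d) (j : Fin d) : coordCount u j ≤ m :=
  (Finset.card_filter_le _ _).trans (by simp)

lemma abs_coordMonomial_eq (u : Fin m → Fin d) (s : EuclideanSpace ℝ (Fin d)) :
    |coordMonomial u s| = ∏ j, |s j| ^ coordCount u j := by
  rw [coordMonomial, Finset.abs_prod, ← Finset.prod_fiberwise Finset.univ u]
  refine Finset.prod_congr rfl fun j _ => ?_
  rw [coordCount, ← Finset.prod_const]
  exact Finset.prod_congr rfl fun l hl => by rw [(Finset.mem_filter.1 hl).2]

/-- Powers of the norm do not factor over coordinates, but monomials do, so they can be integrated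
against a product envelope. -/
lemma norm_pow_le_sum_coordMonomial (k : ℕ) (s : EuclideanSpace ℝ (Fin d)) :
    ‖s‖ ^ k ≤ ∑ w : Fin k → Fin d, |coordMonomial w s| := by
  have h : ‖s‖ ≤ ∑ j, |s j| := by
    rw [EuclideanSpace.norm_eq]
    refine Real.sqrt_le_iff.2 ⟨Finset.sum_nonneg fun _ _ => abs_nonneg _, ?_⟩
    simpa using Finset.sum_sq_le_sq_sum_of_nonneg (s := Finset.univ) (f := fun j => |s j|)
      (fun _ _ => abs_nonneg _)
  calc ‖s‖ ^ k ≤ (∑ j, |s j|) ^ k := by gcongr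
    _ = _ := by simp [Fintype.sum_pow, coordMonomial, Finset.abs_prod]

section Envelope

variable {p : EuclideanSpace ℝ (Fin d) → ℝ} {A : ℝ} {h : ℝ → ℝ} {r : ℕ}

lemma coordMonomial_mul_prod (u : Fin m → Fin d) (h : ℝ → ℝ) (s : EuclideanSpace ℝ (Fin d)) :
    |coordMonomial u s| * ∏ j, h (s j) = ∏ j, (|s j| ^ coordCount u j * h (s j)) := by
  rw [abs_coordMonomial_eq, Finset.prod_mul_distrib]

lemma integrable_norm_pow_mul_angularFourier (hp : Integrable p)
    (hA : ∀ s, ‖angularFourier p s‖ ≤ A * ∏ j, h (s j))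
    (hint : ∀ k ≤ r, Integrable fun t => |t| ^ k * h t) {k : ℕ} (hk : k ≤ r) :
    Integrable fun s => ‖s‖ ^ k * ‖angularFourier p s‖ := by
  have hFc := continuous_angularFourier hp
  have hi : Integrable fun s : EuclideanSpace ℝ (Fin d) => A * ∑ w : Fin k → Fin d,
      |coordMonomial w s| * ∏ j, h (s j) := by
    refine (integrable_finsetSum _ fun w _ => ?_).const_mul A
    simp only [coordMonomial_mul_prod]
    exact integrable_euclidean_prod (f := fun j t => |t| ^ coordCount w j * h t)
      fun j => hint _ ((coordCount_le w j).trans hk)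
  refine hi.mono' (by fun_prop) (.of_forall fun s => ?_)
  rw [norm_mul, norm_pow, norm_norm, norm_norm, ← Finset.sum_mul, ← mul_assoc, mul_comm A, mul_assoc]
  exact mul_le_mul (norm_pow_le_sum_coordMonomial k s) (hA s) (norm_nonneg _)
    (Finset.sum_nonneg fun _ _ => abs_nonneg _)

/-- This `L¹` norm is how the density enters the variance bound, so the constants are uniform over
the smoothness class. -/
lemma integral_norm_angularFourier_le {M : ℝ}
    (hA0 : 0 ≤ A) (hA : ∀ s, ‖angularFourier p s‖ ≤ A * ∏ j, h (s j)) (h0 : ∀ t, 0 ≤ h t)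
    (hint : Integrable h) (hM : ∫ t, h t ≤ M) :
    ∫ s, ‖angularFourier p s‖ ≤ A * M ^ d := by
  have hi := (integrable_euclidean_prod (d := d) (f := fun _ => h) fun _ => hint).const_mul A
  calc ∫ s, ‖angularFourier p s‖ ≤ ∫ s : EuclideanSpace ℝ (Fin d), A * ∏ j, h (s j) :=
        integral_mono_of_nonneg (.of_forall fun _ => norm_nonneg _) hi (.of_forall hA)
    _ = A * (∫ t, h t) ^ d := by
        rw [integral_const_mul, integral_euclidean_prod (fun _ => h)]; simp
    _ ≤ A * M ^ d := by gcongr; exact integral_nonneg h0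

/-- Spectral mass outside the cube, from one-dimensional moments and tails of the envelope. -/
lemma integral_compl_centeredCube_le {M B R : ℝ} (hA0 : 0 ≤ A)
    (hA : ∀ s, ‖angularFourier p s‖ ≤ A * ∏ j, h (s j)) (h0 : ∀ t, 0 ≤ h t)
    (u : Fin m → Fin d) (hint : ∀ k ≤ m, Integrable fun t => |t| ^ k * h t)
    (hM : ∀ k ≤ m, ∫ t, |t| ^ k * h t ≤ M)
    (hB : ∀ k ≤ m, ∫ t in {t | R < |t|}, |t| ^ k * h t ≤ B) :
    ∫ s in (centeredCube d R)ᶜ, |coordMonomial u s| * ‖angularFourier p s‖ ≤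
      A * (d * (B * M ^ (d - 1))) := by
  classical
  have hms : MeasurableSet {t : ℝ | R < |t|} := measurableSet_lt measurable_const (by fun_prop)
  -- The `j`-th product keeps only the tail in coordinate `j` and the full envelope in the others;
  -- summing over `j` covers the complement of the cube.
  set f : Fin d → Fin d → ℝ → ℝ := fun j l =>
    if l = j then {t | R < |t|}.indicator (fun t => |t| ^ coordCount u l * h t)
    else fun t => |t| ^ coordCount u l * h t with hf
  have hfi : ∀ j l, Integrable (f j l) := fun j l => by
    simp only [hf]
    split_ifs
    · exact (hint _ (coordCount_le u l)).indicator hms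
    · exact hint _ (coordCount_le u l)
  have hf0 : ∀ j l t, 0 ≤ f j l t := fun j l t => by
    have : ∀ t, 0 ≤ |t| ^ coordCount u l * h t := fun t => mul_nonneg (by positivity) (h0 t)
    simp only [hf]
    split_ifs
    · exact Set.indicator_nonneg (fun t _ => this t) t
    · exact this t
  rw [← integral_indicator (measurableSet_centeredCube d R).compl]
  have hle : ∀ s : EuclideanSpace ℝ (Fin d), (centeredCube d R)ᶜ.indicator
      (fun s => |coordMonomial u s| * ‖angularFourier p s‖) s ≤ A * ∑ j, ∏ l, f j l (s l) := by
    intro s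
    have hnn : ∀ j, 0 ≤ ∏ l, f j l (s l) := fun j => Finset.prod_nonneg fun l _ => hf0 j l _
    by_cases hs : s ∈ (centeredCube d R)ᶜ
    · rw [Set.indicator_of_mem hs]
      have : ∃ j, R < |s j| := by
        simpa [centeredCube] using hs
      obtain ⟨j, hj⟩ := this
      have hAp : 0 ≤ |coordMonomial u s| := abs_nonneg _
      calc |coordMonomial u s| * ‖angularFourier p s‖
          ≤ |coordMonomial u s| * (A * ∏ j, h (s j)) := by gcongr; exact hA s
        _ = A * ∏ l, f j l (s l) := by
            rw [mul_left_comm, coordMonomial_mul_prod]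
            congr 1
            refine Finset.prod_congr rfl fun l _ => ?_
            simp only [hf]
            split_ifs with hl
            · subst hl
              rw [Set.indicator_of_mem]
              exact hj
            · rfl
        _ ≤ _ := by
            gcongr
            exact Finset.single_le_sum (f := fun j => ∏ l, f j l (s l)) (fun j _ => hnn j)
              (Finset.mem_univ j)
    · rw [Set.indicator_of_notMem hs]
      exact mul_nonneg hA0 (Finset.sum_nonneg fun j _ => hnn j)
  have hle0 : ∀ s, 0 ≤ (centeredCube d R)ᶜ.indicator
      (fun s => |coordMonomial u s| * ‖angularFourier p s‖) s :=
    Set.indicator_nonneg fun s _ => mul_nonneg (abs_nonneg _) (norm_nonneg _)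
  have hi : ∀ j, Integrable fun s : EuclideanSpace ℝ (Fin d) => ∏ l, f j l (s l) :=
    fun j => integrable_euclidean_prod (hfi j)
  calc ∫ s, (centeredCube d R)ᶜ.indicator
        (fun s => |coordMonomial u s| * ‖angularFourier p s‖) s
      ≤ ∫ s : EuclideanSpace ℝ (Fin d), A * ∑ j, ∏ l, f j l (s l) :=
        integral_mono_of_nonneg
          (.of_forall hle0)
          ((integrable_finsetSum _ fun j _ => hi j).const_mul A) (.of_forall hle)
    _ = A * ∑ j, ∏ l, ∫ t, f j l t := by
        rw [integral_const_mul, integral_finsetSum _ fun j _ => hi j]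
        simp only [integral_euclidean_prod]
    _ ≤ A * ∑ j : Fin d, (B * M ^ (d - 1)) := by
        gcongr with j
        rw [← Finset.mul_prod_erase Finset.univ (fun l => ∫ t, f j l t) (Finset.mem_univ j)]
        have hj : ∫ t, f j j t ≤ B := by
          simp only [hf, if_true]
          rw [integral_indicator hms]
          exact hB _ (coordCount_le u j)
        have hl : ∏ l ∈ Finset.univ.erase j, ∫ t, f j l t ≤ M ^ (d - 1) := by
          refine (Finset.prod_le_prod (g := fun _ => M)
            (fun l _ => integral_nonneg (μ := volume) (hf0 j l)) fun l hl => ?_).trans (by simp)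
          simp only [hf, if_neg (Finset.ne_of_mem_erase hl)]
          exact hM _ (coordCount_le u l)
        exact mul_le_mul hj hl (Finset.prod_nonneg fun l _ => integral_nonneg (hf0 j l))
          ((integral_nonneg (hf0 j j)).trans hj)
    _ = _ := by simp

end Envelope

/-! ### One-dimensional tail integrals. -/

lemma integrableOn_Iio_of_even {f : ℝ → ℝ} (hf : ∀ t, f (-t) = f t) {R : ℝ}
    (hi : IntegrableOn f (Set.Ioi R)) : IntegrableOn f (Set.Iio (-R)) := by
  have := ((Measure.measurePreserving_neg (volume : Measure ℝ)).integrableOn_comp_preimage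
    (MeasurableEquiv.neg ℝ).measurableEmbedding (f := f) (s := Set.Ioi R)).2 hi
  simpa [Function.comp_def, hf] using this

lemma integrable_of_even {f : ℝ → ℝ} (hf : ∀ t, f (-t) = f t) (hi : IntegrableOn f (Set.Ioi 0)) :
    Integrable f := by
  have h := integrableOn_Iio_of_even hf hi
  rw [neg_zero, ← integrableOn_Iic_iff_integrableOn_Iio] at h
  have := h.union hi
  rwa [Set.Iic_union_Ioi, integrableOn_univ] at this

lemma setIntegral_abs_gt_of_even {f : ℝ → ℝ} (hf : ∀ t, f (-t) = f t) {R : ℝ} (hR : 0 ≤ R)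
    (hi : IntegrableOn f (Set.Ioi R)) :
    ∫ t in {t | R < |t|}, f t = 2 * ∫ t in Set.Ioi R, f t := by
  have hset : {t : ℝ | R < |t|} = Set.Iio (-R) ∪ Set.Ioi R := by
    ext t; simp [lt_abs, or_comm, lt_neg]
  have hd : Disjoint (Set.Iio (-R)) (Set.Ioi R) := by
    rw [Set.disjoint_left]
    intro t ht ht'
    simp only [Set.mem_Iio, Set.mem_Ioi] at ht ht'
    linarith
  rw [hset, setIntegral_union hd measurableSet_Ioi (integrableOn_Iio_of_even hf hi) hi, two_mul]
  congr 1
  have := integral_comp_neg_Ioi R f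
  simp only [hf] at this
  rw [this, integral_Iic_eq_integral_Iio]

/-- Tail of `t ^ k * exp (-c t ^ α)`: integrability and the bound of Laplace type. -/
lemma integral_Ioi_pow_mul_exp_le {α c : ℝ} (hα : 0 < α) (hc : 0 < c) (k i : ℕ) (hki : k ≤ i)
    {R : ℝ} (hR : 1 ≤ R) (hRc : 2 * max (1 + (i : ℝ) - α) 0 ≤ c * α * R ^ α) :
    IntegrableOn (fun t : ℝ => t ^ k * Real.exp (-c * t ^ α)) (Set.Ioi R) ∧
    ∫ t in Set.Ioi R, t ^ k * Real.exp (-c * t ^ α) ≤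
      2 / (c * α) * (R ^ max (1 + (i : ℝ) - α) 0 * Real.exp (-c * R ^ α)) := by
  set γ := max (1 + (i : ℝ) - α) 0 with hγ
  have hγ0 : 0 ≤ γ := le_max_right _ _
  have hγ1 : 1 + (i : ℝ) - α ≤ γ := le_max_left _ _
  -- The derivative of `g` is `t ^ (γ - 1) * (2 * t ^ α - 2 * γ / (c * α)) * exp (-c * t ^ α)`. By
  -- `hRc` the subtracted term is at most `t ^ α` for `t ≥ R`, and `γ - 1 + α ≥ i ≥ k`, so the
  -- derivative dominates the integrand. The coefficient `2` leaves the room for this.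
  set g : ℝ → ℝ := fun t => -(2 / (c * α)) * (t ^ γ * Real.exp (-c * t ^ α)) with hg
  set g' : ℝ → ℝ := fun t => -(2 / (c * α)) * (γ * t ^ (γ - 1) * Real.exp (-c * t ^ α) +
    t ^ γ * (Real.exp (-c * t ^ α) * (-c * (α * t ^ (α - 1))))) with hg'
  have hderiv : ∀ t : ℝ, 0 < t → HasDerivAt g (g' t) t := fun t ht =>
    (((Real.hasDerivAt_rpow_const (Or.inl ht.ne')).mul
      (((Real.hasDerivAt_rpow_const (Or.inl ht.ne')).const_mul (-c)).exp)).const_mul _)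
  have hle : ∀ t : ℝ, R ≤ t → t ^ k * Real.exp (-c * t ^ α) ≤ g' t := by
    intro t ht
    have ht1 : 1 ≤ t := hR.trans ht
    have ht0 : 0 < t := by linarith
    have e1 : g' t = t ^ (γ - 1) * (2 * t ^ α - 2 * γ / (c * α)) * Real.exp (-c * t ^ α) := by
      have : t ^ γ * t ^ (α - 1) = t ^ (γ - 1) * t ^ α := by
        rw [← Real.rpow_add ht0, ← Real.rpow_add ht0]; ring_nf
      simp only [hg']
      calc _ = (2 * (t ^ γ * t ^ (α - 1)) * (c * α / (c * α)) -
            2 * γ / (c * α) * t ^ (γ - 1)) * Real.exp (-c * t ^ α) := by ring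
        _ = _ := by rw [div_self (by positivity), this]; ring
    rw [e1]
    gcongr
    have h1 : 2 * γ / (c * α) ≤ t ^ α := by
      rw [div_le_iff₀ (by positivity)]
      have : R ^ α ≤ t ^ α := Real.rpow_le_rpow (by linarith) ht hα.le
      nlinarith [mul_le_mul_of_nonneg_left this (by positivity : 0 ≤ c * α)]
    calc t ^ k = t ^ (k : ℝ) := (Real.rpow_natCast t k).symm
      _ ≤ t ^ (γ - 1 + α) := by
          apply Real.rpow_le_rpow_of_exponent_le ht1
          have : (k : ℝ) ≤ i := by exact_mod_cast hki
          linarith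
      _ = t ^ (γ - 1) * t ^ α := Real.rpow_add ht0 _ _
      _ ≤ _ := by
          gcongr
          linarith
  have hlim : Filter.Tendsto g Filter.atTop (nhds 0) := by
    have h1 : Filter.Tendsto (fun y : ℝ => y ^ (γ / α) * Real.exp (-c * y)) Filter.atTop (nhds 0) :=
      tendsto_rpow_mul_exp_neg_mul_atTop_nhds_zero _ _ hc
    have h2 := (h1.comp (tendsto_rpow_atTop hα)).const_mul (-(2 / (c * α)))
    rw [mul_zero] at h2
    refine h2.congr' ?_
    filter_upwards [Filter.eventually_gt_atTop 0] with t ht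
    simp only [Function.comp_apply, hg]
    rw [← Real.rpow_mul ht.le]
    congr 4
    field_simp
  have hR0 : 0 < R := by linarith
  have hg'0 : ∀ t ∈ Set.Ioi R, 0 ≤ g' t := fun t ht =>
    le_trans (by have : (0:ℝ) ≤ t := hR0.le.trans (le_of_lt ht); positivity) (hle t (le_of_lt ht))
  have hcont : ContinuousWithinAt g (Set.Ici R) R := (hderiv R hR0).continuousAt.continuousWithinAt
  have hd' : ∀ t ∈ Set.Ioi R, HasDerivAt g (g' t) t := fun t ht => hderiv t (hR0.trans ht)
  have hgi : IntegrableOn g' (Set.Ioi R) :=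
    integrableOn_Ioi_deriv_of_nonneg hcont hd' hg'0 hlim
  have hint := integral_Ioi_of_hasDerivAt_of_nonneg hcont hd' hg'0 hlim
  have hfi : IntegrableOn (fun t : ℝ => t ^ k * Real.exp (-c * t ^ α)) (Set.Ioi R) := by
    refine hgi.mono' (Measurable.aestronglyMeasurable (by fun_prop)) ?_
    refine (ae_restrict_iff' measurableSet_Ioi).2 (.of_forall fun t ht => ?_)
    have : (0:ℝ) ≤ t := hR0.le.trans (le_of_lt ht)
    rw [Real.norm_of_nonneg (by positivity)]
    exact hle t (le_of_lt ht)
  refine ⟨hfi, ?_⟩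
  calc _ ≤ ∫ t in Set.Ioi R, g' t :=
        setIntegral_mono_on hfi hgi measurableSet_Ioi fun t ht => hle t (le_of_lt ht)
    _ = _ := by rw [hint]; simp only [hg]; ring

/-- Tail of `t ^ k / (1 + t ^ β)`. -/
lemma integral_Ioi_pow_div_le {β : ℝ} (k : ℕ) (hβ : (k : ℝ) + 1 < β) {R : ℝ} (hR : 1 ≤ R) :
    IntegrableOn (fun t : ℝ => t ^ k * (1 / (1 + t ^ β))) (Set.Ioi R) ∧
    ∫ t in Set.Ioi R, t ^ k * (1 / (1 + t ^ β)) ≤ R ^ ((k : ℝ) + 1 - β) / (β - k - 1) := by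
  have hR0 : 0 < R := by linarith
  have ha : (k : ℝ) - β < -1 := by linarith
  have hle : ∀ t ∈ Set.Ioi R, t ^ k * (1 / (1 + t ^ β)) ≤ t ^ ((k : ℝ) - β) := fun t ht => by
    have ht0 : 0 < t := hR0.trans ht
    rw [Real.rpow_sub ht0, Real.rpow_natCast, mul_one_div]
    gcongr
    linarith
  have hgi := integrableOn_Ioi_rpow_of_lt ha hR0
  have hfi : IntegrableOn (fun t : ℝ => t ^ k * (1 / (1 + t ^ β))) (Set.Ioi R) := by
    refine hgi.mono' (Measurable.aestronglyMeasurable (by fun_prop)) ?_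
    refine (ae_restrict_iff' measurableSet_Ioi).2 (.of_forall fun t ht => ?_)
    have : (0:ℝ) ≤ t := hR0.le.trans (le_of_lt ht)
    rw [Real.norm_of_nonneg (by positivity)]
    exact hle t ht
  refine ⟨hfi, (setIntegral_mono_on hfi hgi measurableSet_Ioi hle).trans (le_of_eq ?_)⟩
  rw [integral_Ioi_rpow_of_lt ha hR0, show (k : ℝ) - β + 1 = (k : ℝ) + 1 - β by ring, ← neg_div_neg_eq,
    neg_neg]
  congr 1
  ring

/-! ### Deviation of the fluctuation at a point. -/

/-- **Chernoff bound of Bernstein type** for centered independent variables. -/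
lemma measure_sum_ge_le_exp {Ω : Type*} [MeasurableSpace Ω] {P : Measure Ω}
    [IsProbabilityMeasure P] {W : Fin n → Ω → ℝ} (hmeas : ∀ k, Measurable (W k))
    (hind : iIndepFun W P) {l v : ℝ} (hl : 0 ≤ l) (hb : ∀ k ω, |l * W k ω| ≤ 1)
    (hmean : ∀ k, ∫ ω, W k ω ∂P = 0) (hWi : ∀ k, Integrable (W k) P)
    (hWi2 : ∀ k, Integrable (fun ω => W k ω ^ 2) P) (hv : ∀ k, ∫ ω, W k ω ^ 2 ∂P ≤ v) (τ : ℝ) :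
    P.real {ω | n * τ ≤ ∑ k, W k ω} ≤ Real.exp (n * (l ^ 2 * v - l * τ)) := by
  -- This is `e^y ≤ 1 + y + y²` for `|y| ≤ 1`; the linear term vanishes in the mean.
  have hexp : ∀ k ω, Real.exp (l * W k ω) ≤ 1 + l * W k ω + l ^ 2 * W k ω ^ 2 := fun k ω => by
    have := (abs_le.1 (Real.abs_exp_sub_one_sub_id_le (hb k ω))).2
    nlinarith
  have hei : ∀ k, Integrable (fun ω => Real.exp (l * W k ω)) P := fun k => by
    refine Integrable.of_bound (C := Real.exp 1) ?_ (.of_forall fun ω => ?_)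
    · exact (Real.measurable_exp.comp ((hmeas k).const_mul l)).aestronglyMeasurable
    · rw [Real.norm_eq_abs, Real.abs_exp]
      exact Real.exp_le_exp.2 (abs_le.1 (hb k ω)).2
  have hmgf : ∀ k, mgf (W k) P l ≤ Real.exp (l ^ 2 * v) := fun k => by
    calc mgf (W k) P l ≤ ∫ ω, (1 + l * W k ω + l ^ 2 * W k ω ^ 2) ∂P :=
          integral_mono (hei k) (((integrable_const _).add ((hWi k).const_mul l)).add
            ((hWi2 k).const_mul _)) (hexp k)
      _ = 1 + l ^ 2 * ∫ ω, W k ω ^ 2 ∂P := by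
          have h1 : Integrable (fun ω => 1 + l * W k ω) P :=
            (integrable_const _).add ((hWi k).const_mul l)
          rw [integral_add h1 ((hWi2 k).const_mul _),
            integral_add (integrable_const _) ((hWi k).const_mul l), integral_const_mul,
            integral_const_mul, hmean]
          simp
      _ ≤ l ^ 2 * v + 1 := by nlinarith [hv k, sq_nonneg l]
      _ ≤ _ := Real.add_one_le_exp _
  have h := measure_ge_le_exp_mul_mgf (μ := P) (X := ∑ k, W k) (n * τ) hl
    (hind.integrable_exp_mul_sum hmeas fun k _ => hei k)
  simp only [Finset.sum_apply] at h
  refine h.trans ?_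
  rw [hind.mgf_sum hmeas]
  calc Real.exp (-l * (n * τ)) * ∏ k, mgf (W k) P l
      ≤ Real.exp (-l * (n * τ)) * ∏ _k : Fin n, Real.exp (l ^ 2 * v) := by
        gcongr with k
        · exact fun k _ => mgf_nonneg
        · exact hmgf k
    _ = _ := by
        rw [Finset.prod_const, Finset.card_univ, Fintype.card_fin, ← Real.exp_nat_mul,
          ← Real.exp_add]
        ring_nf

/-- Fubini for a bounded continuous kernel. -/
lemma integral_mul_kernel_swap {μ ν : Measure (EuclideanSpace ℝ (Fin d))} [SFinite μ] [SFinite ν]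
    {κ : EuclideanSpace ℝ (Fin d) → EuclideanSpace ℝ (Fin d) → ℂ}
    (hκ : Continuous fun z : EuclideanSpace ℝ (Fin d) × EuclideanSpace ℝ (Fin d) => κ z.1 z.2)
    (hκ1 : ∀ s t, ‖κ s t‖ ≤ 1) {a g : EuclideanSpace ℝ (Fin d) → ℂ} (ha : Integrable a μ)
    (hg : Integrable g ν) :
    ∫ t, (∫ s, a s * κ s t ∂μ) * g t ∂ν = ∫ s, a s * (∫ t, κ s t * g t ∂ν) ∂μ := by
  simp only [← integral_mul_const, ← integral_const_mul]
  rw [integral_integral_swap]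
  · simp only [mul_assoc]
  · have h : Integrable (fun z : EuclideanSpace ℝ (Fin d) × EuclideanSpace ℝ (Fin d) =>
        g z.1 * a z.2) (ν.prod μ) := hg.mul_prod ha
    refine h.norm.mono' ?_ (.of_forall fun z => ?_)
    · exact (ha.1.comp_snd.mul (hκ.comp continuous_swap).aestronglyMeasurable).mul hg.1.comp_fst
    · simp only [Function.uncurry, norm_mul]
      have := hκ1 z.2 z.1
      calc ‖a z.2‖ * ‖κ z.2 z.1‖ * ‖g z.1‖ ≤ ‖a z.2‖ * 1 * ‖g z.1‖ := by gcongr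
        _ = _ := by ring

/-- The contribution of an observation `t` to the differentiated estimator, up to the factor
`1/n`. -/
def kernelTerm (R : ℝ) (u : Fin m → Fin d) (x t : EuclideanSpace ℝ (Fin d)) : ℂ :=
  ∫ s in centeredCube d R,
    (inversionConst d * (Complex.I ^ m * (coordMonomial u s : ℂ) * planeWave s x)) * planeWave s (-t)

lemma norm_amplitude_le {R : ℝ} (u : Fin m → Fin d) (x : EuclideanSpace ℝ (Fin d))
    {s : EuclideanSpace ℝ (Fin d)} (hs : s ∈ centeredCube d R) :
    ‖(inversionConst d * (Complex.I ^ m * (coordMonomial u s : ℂ) * planeWave s x) : ℂ)‖ ≤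
      inversionConst d * R ^ m := by
  simp only [norm_mul, norm_pow, Complex.norm_I, one_pow, one_mul, norm_planeWave, mul_one,
    Complex.norm_real, Real.norm_eq_abs, abs_of_pos (inversionConst_pos d)]
  exact mul_le_mul_of_nonneg_left (abs_coordMonomial_le_pow u hs) (inversionConst_pos d).le

lemma norm_kernelTerm_le {R : ℝ} (hR : 0 ≤ R) (u : Fin m → Fin d)
    (x t : EuclideanSpace ℝ (Fin d)) :
    ‖kernelTerm R u x t‖ ≤ inversionConst d * R ^ m * (2 * R) ^ d := by
  rw [kernelTerm, ← volume_real_centeredCube hR]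
  refine norm_setIntegral_le_of_norm_le_const (isCompact_centeredCube d R).measure_lt_top
    fun s hs => ?_
  rw [norm_mul, norm_planeWave, mul_one]
  exact norm_amplitude_le u x hs

lemma continuous_planeWave_neg : Continuous fun z : EuclideanSpace ℝ (Fin d) ×
    EuclideanSpace ℝ (Fin d) => planeWave z.1 (-z.2) := by
  unfold planeWave; fun_prop

@[fun_prop]
lemma continuous_planeWave_neg_right (s : EuclideanSpace ℝ (Fin d)) :
    Continuous fun t => planeWave s (-t) := by
  unfold planeWave; fun_prop

lemma continuous_kernelTerm {R : ℝ} (u : Fin m → Fin d) (x : EuclideanSpace ℝ (Fin d)) :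
    Continuous (kernelTerm R u x) := by
  unfold kernelTerm
  refine continuous_of_dominated (bound := fun _ => inversionConst d * R ^ m)
    (fun t => Continuous.aestronglyMeasurable (by fun_prop)) (fun t => ?_) (integrable_const _)
    (.of_forall fun s => ?_)
  · refine (ae_restrict_iff' (measurableSet_centeredCube d R)).2 (.of_forall fun s hs => ?_)
    rw [norm_mul, norm_planeWave, mul_one]
    exact norm_amplitude_le u x hs
  · exact continuous_const.mul (continuous_planeWave_neg_right s)

lemma integrable_amplitude (R : ℝ) (u : Fin m → Fin d) (x : EuclideanSpace ℝ (Fin d)) :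
    IntegrableOn (fun s => (inversionConst d * (Complex.I ^ m * (coordMonomial u s : ℂ) *
      planeWave s x) : ℂ)) (centeredCube d R) :=
  (Continuous.continuousOn (by fun_prop)).integrableOn_compact (isCompact_centeredCube d R)

/-- The mean contribution of an observation with density `p`. -/
lemma integral_kernelTerm_mul (R : ℝ) (u : Fin m → Fin d) (x : EuclideanSpace ℝ (Fin d))
    {p : EuclideanSpace ℝ (Fin d) → ℝ} (hp : Integrable p) :
    ∫ t, kernelTerm R u x t * p t =
      synthesis (volume.restrict (centeredCube d R))
        (fun s => inversionConst d * angularFourier p s) u x := by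
  refine (integral_mul_kernel_swap (κ := fun s t => planeWave s (-t)) continuous_planeWave_neg
    (fun s t => (norm_planeWave _ _).le) (integrable_amplitude R u x) hp.ofReal).trans ?_
  rw [synthesis]
  refine integral_congr_ae (.of_forall fun s => ?_)
  change _ * (∫ t, planeWave s (-t) * (p t : ℂ)) = _
  rw [← angularFourier_eq_planeWave]
  ring

lemma conj_planeWave (s x : EuclideanSpace ℝ (Fin d)) :
    (starRingEnd ℂ) (planeWave s x) = planeWave s (-x) := by
  simp [planeWave, ← Complex.exp_conj]

/-- The second moment of the contribution of an observation, from the `L¹` norm of the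
characteristic function. -/
lemma integral_sq_norm_kernelTerm_mul_le {R : ℝ} (hR : 0 ≤ R) (u : Fin m → Fin d)
    (x : EuclideanSpace ℝ (Fin d)) {p : EuclideanSpace ℝ (Fin d) → ℝ} (hp : IsProbDensity p)
    (hF : Integrable (angularFourier p)) {M : ℝ} (hM : ∫ s, ‖angularFourier p s‖ ≤ M) :
    ∫ t, ‖kernelTerm R u x t‖ ^ 2 * p t ≤ (inversionConst d * R ^ m) ^ 2 * (2 * R) ^ d * M := by
  set c := inversionConst d
  have hc0 : 0 < c := inversionConst_pos d
  set a : EuclideanSpace ℝ (Fin d) → ℂ := fun s =>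
    c * (Complex.I ^ m * (coordMonomial u s : ℂ) * planeWave s x) with ha
  set μ := (volume : Measure (EuclideanSpace ℝ (Fin d))).restrict (centeredCube d R)
  set G := kernelTerm R u x with hG
  have hGd : ∀ t, G t = ∫ s, a s * planeWave s (-t) ∂μ := fun t => rfl
  have hai : Integrable a μ := integrable_amplitude R u x
  have haic : Integrable (fun s => (starRingEnd ℂ) (a s)) μ :=
    (LinearIsometryEquiv.integrable_comp_iff Complex.conjLIE).2 hai
  have hGc : Continuous G := continuous_kernelTerm u x
  have hgi : Integrable fun t => (starRingEnd ℂ) (G t) * p t := by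
    refine (hp.2.1.norm.const_mul (c * R ^ m * (2 * R) ^ d)).mono' ?_ (.of_forall fun t => ?_)
    · exact (Complex.continuous_conj.comp hGc).aestronglyMeasurable.mul hp.2.1.ofReal.1
    · rw [norm_mul, RCLike.norm_conj, Complex.norm_real]
      exact mul_le_mul_of_nonneg_right (norm_kernelTerm_le hR u x t) (norm_nonneg _)
  have hFs : ∀ s, Integrable fun s' => angularFourier p (s - s') := fun s => hF.comp_sub_left s
  have hM' : ∀ s, ∫ s', ‖angularFourier p (s - s')‖ ≤ M := fun s => by
    rw [integral_sub_left_eq_self (fun s' => ‖angularFourier p s'‖) volume s]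
    exact hM
  have h0M : 0 ≤ M := (integral_nonneg fun _ => norm_nonneg _).trans hM
  -- Expanding `conj (G t)` turns this integral into a convolution of the conjugate amplitude with
  -- the characteristic function, bounded by the amplitude times `M`. Only the outer integral then
  -- contributes a volume factor `(2 * R) ^ d`.
  have hinner : ∀ s, ‖∫ t, planeWave s (-t) * ((starRingEnd ℂ) (G t) * p t)‖ ≤ c * R ^ m * M := by
    intro s
    have e : ∫ t, planeWave s (-t) * ((starRingEnd ℂ) (G t) * p t) =
        ∫ s', (starRingEnd ℂ) (a s') * angularFourier p (s - s') ∂μ := by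
      have e1 : ∀ t, planeWave s (-t) * ((starRingEnd ℂ) (G t) * p t) =
          (∫ s', (starRingEnd ℂ) (a s') * planeWave s' t ∂μ) * (planeWave s (-t) * p t) := by
        intro t
        rw [hGd, ← integral_conj]
        simp only [map_mul, conj_planeWave, neg_neg]
        ring
      simp only [e1]
      rw [integral_mul_kernel_swap continuous_planeWave (fun s t => (norm_planeWave _ _).le) haic]
      · refine integral_congr_ae (.of_forall fun s' => ?_)
        simp only [angularFourier_eq_planeWave]
        congr 1
        refine integral_congr_ae (.of_forall fun t => ?_)
        simp only [← mul_assoc]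
        congr 1
        simp only [planeWave, ← Complex.exp_add, inner_sub_left, inner_neg_right]
        congr 1
        push_cast
        ring
      · refine hp.2.1.norm.mono' ?_ (.of_forall fun t => by simp [norm_planeWave])
        exact (continuous_planeWave_neg_right s).aestronglyMeasurable.mul hp.2.1.ofReal.1
    rw [e]
    calc ‖∫ s', (starRingEnd ℂ) (a s') * angularFourier p (s - s') ∂μ‖
        ≤ ∫ s', c * R ^ m * ‖angularFourier p (s - s')‖ ∂μ := by
          refine norm_integral_le_of_norm_le ((hFs s).norm.const_mul _).integrableOn
            ((ae_restrict_iff' (measurableSet_centeredCube d R)).2 (.of_forall fun s' hs' => ?_))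
          rw [norm_mul, RCLike.norm_conj]
          exact mul_le_mul_of_nonneg_right (norm_amplitude_le u x hs') (norm_nonneg _)
      _ ≤ c * R ^ m * M := by
          rw [integral_const_mul]
          gcongr
          exact (setIntegral_le_integral (hFs s).norm (.of_forall fun _ => norm_nonneg _)).trans
            (hM' s)
  have hmain : ((∫ t, ‖G t‖ ^ 2 * p t : ℝ) : ℂ) =
      ∫ s, a s * (∫ t, planeWave s (-t) * ((starRingEnd ℂ) (G t) * p t)) ∂μ := by
    rw [← integral_mul_kernel_swap continuous_planeWave_neg (fun s t => (norm_planeWave _ _).le)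
      hai hgi, ← integral_complex_ofReal]
    refine integral_congr_ae (.of_forall fun t => ?_)
    simp only [← hGd]
    rw [← mul_assoc, Complex.mul_conj, Complex.normSq_eq_norm_sq]
    push_cast
    ring
  calc ∫ t, ‖G t‖ ^ 2 * p t ≤ ‖((∫ t, ‖G t‖ ^ 2 * p t : ℝ) : ℂ)‖ := by
        rw [Complex.norm_real]; exact le_abs_self _
    _ ≤ (c * R ^ m * (c * R ^ m * M)) * volume.real (centeredCube d R) := by
        rw [hmain]
        refine norm_setIntegral_le_of_norm_le_const (isCompact_centeredCube d R).measure_lt_top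
          fun s hs => ?_
        rw [norm_mul]
        exact mul_le_mul (norm_amplitude_le u x hs) (hinner s) (norm_nonneg _) (by positivity)
    _ = _ := by rw [volume_real_centeredCube hR]; ring

/-- By linearity of the spectral integral, the fluctuation is an average of centered independent
terms, to which the Chernoff bound applies. -/
lemma fluctuation_eq (R : ℝ) (hn : 1 ≤ n) (X : Fin n → EuclideanSpace ℝ (Fin d))
    {p : EuclideanSpace ℝ (Fin d) → ℝ} (hp : Integrable p) (u : Fin m → Fin d)
    (x : EuclideanSpace ℝ (Fin d)) :
    n * fluctuation R X p u x =
      ∑ k, ((kernelTerm R u x (X k)).re - (∫ t, kernelTerm R u x t * p t).re) := by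
  have hn' : (n : ℂ) ≠ 0 := by exact_mod_cast (by omega : n ≠ 0)
  have hFc := continuous_angularFourier hp
  have hi : ∀ k, IntegrableOn (fun s => (inversionConst d *
      (Complex.I ^ m * (coordMonomial u s : ℂ) * planeWave s x)) * planeWave s (-X k))
      (centeredCube d R) := fun k =>
    (Continuous.continuousOn (by fun_prop)).integrableOn_compact (isCompact_centeredCube d R)
  have e : (n : ℂ) * synthesis (volume.restrict (centeredCube d R))
      (fun s => inversionConst d * (empiricalFourier X s - angularFourier p s)) u x =
      ∑ k, (kernelTerm R u x (X k) - ∫ t, kernelTerm R u x t * p t) := by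
    rw [Finset.sum_sub_distrib, integral_kernelTerm_mul R u x hp]
    simp only [Finset.sum_const, Finset.card_univ, Fintype.card_fin, nsmul_eq_mul, kernelTerm]
    rw [← integral_finsetSum _ fun k _ => hi k, synthesis, synthesis, ← integral_const_mul,
      ← integral_const_mul, ← integral_sub (integrable_finsetSum _ fun k _ => hi k)]
    · refine integral_congr_ae (.of_forall fun s => ?_)
      simp only [← Finset.mul_sum, empiricalFourier]
      field_simp
    · exact (Continuous.continuousOn (by fun_prop)).integrableOn_compact
        (isCompact_centeredCube d R)
  rw [fluctuation]
  have := congrArg Complex.re e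
  simpa using this

lemma integral_comp_sample {Ω : Type*} [MeasurableSpace Ω] {P : Measure Ω}
    {p : EuclideanSpace ℝ (Fin d) → ℝ} (hp : IsProbDensity p)
    {X : Fin n → Ω → EuclideanSpace ℝ (Fin d)} (hX : IsIIDSample P p X) (k : Fin n)
    {𝕜 : Type*} [RCLike 𝕜] {g : EuclideanSpace ℝ (Fin d) → 𝕜} (hg : Continuous g) :
    ∫ ω, g (X k ω) ∂P = ∫ t, g t * (p t : 𝕜) := by
  rw [← integral_map (hX.1 k).aemeasurable hg.aestronglyMeasurable, hX.2.2 k,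
    integral_withDensity_eq_integral_toReal_smul₀ hp.2.1.1.aemeasurable.ennreal_ofReal
      (.of_forall fun _ => ENNReal.ofReal_lt_top)]
  refine integral_congr_ae (.of_forall fun t => ?_)
  simp only [ENNReal.toReal_ofReal (hp.1 t)]
  rw [RCLike.real_smul_eq_coe_mul, mul_comm]

/-- Deviation inequality for the fluctuation at a point. -/
lemma measure_abs_fluctuation_ge_le {Ω : Type*} [MeasurableSpace Ω] {P : Measure Ω}
    [IsProbabilityMeasure P] {p : EuclideanSpace ℝ (Fin d) → ℝ} (hp : IsProbDensity p)
    {X : Fin n → Ω → EuclideanSpace ℝ (Fin d)} (hX : IsIIDSample P p X) (hn : 1 ≤ n)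
    (hF : Integrable (angularFourier p)) {M : ℝ} (hM : ∫ s, ‖angularFourier p s‖ ≤ M)
    {R l : ℝ} (hR : 0 ≤ R) (hl : 0 ≤ l) (u : Fin m → Fin d) (x : EuclideanSpace ℝ (Fin d))
    (hlb : l * (2 * (inversionConst d * R ^ m * (2 * R) ^ d)) ≤ 1) (τ : ℝ) :
    P {ω | τ ≤ |fluctuation R (fun k => X k ω) p u x|} ≤ ENNReal.ofReal (2 * Real.exp (n *
      (l ^ 2 * ((inversionConst d * R ^ m) ^ 2 * (2 * R) ^ d * M) - l * τ))) := by
  set b := inversionConst d * R ^ m * (2 * R) ^ d with hb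
  set v := (inversionConst d * R ^ m) ^ 2 * (2 * R) ^ d * M with hv
  have hGc : Continuous (kernelTerm R u x) := continuous_kernelTerm u x
  have hgc : Continuous fun t => (kernelTerm R u x t).re := Complex.continuous_re.comp hGc
  have hgb : ∀ t, |(kernelTerm R u x t).re| ≤ b := fun t =>
    (Complex.abs_re_le_norm _).trans (norm_kernelTerm_le hR u x t)
  set e := (∫ t, kernelTerm R u x t * p t).re with he
  have hGpi : Integrable fun t => kernelTerm R u x t * p t := by
    refine (hp.2.1.norm.const_mul b).mono' (hGc.aestronglyMeasurable.mul hp.2.1.ofReal.1)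
      (.of_forall fun t => ?_)
    rw [norm_mul, Complex.norm_real]
    exact mul_le_mul_of_nonneg_right (norm_kernelTerm_le hR u x t) (norm_nonneg _)
  have he' : e = ∫ t, (kernelTerm R u x t).re * p t := by
    rw [he, ← RCLike.re_eq_complex_re, ← integral_re hGpi]
    simp
  have heb : |e| ≤ b := by
    rw [he', ← Real.norm_eq_abs]
    have : ∫ t, b * p t = b := by rw [integral_const_mul, hp.2.2, mul_one]
    rw [← this]
    refine norm_integral_le_of_norm_le (hp.2.1.const_mul b) (.of_forall fun t => ?_)
    rw [norm_mul, Real.norm_eq_abs, Real.norm_eq_abs, abs_of_nonneg (hp.1 t)]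
    exact mul_le_mul_of_nonneg_right (hgb t) (hp.1 t)
  -- The sign `σ = ±1` treats both tails at once. Centered terms are bounded by `2 * b`, since the
  -- mean `e` is also at most `b` in absolute value.
  have key : ∀ σ : ℝ, |σ| = 1 → P.real {ω | n * τ ≤ ∑ k, σ * ((kernelTerm R u x (X k ω)).re - e)} ≤
      Real.exp (n * (l ^ 2 * v - l * τ)) := by
    intro σ hσ
    have hσ2 : σ ^ 2 = 1 := by rw [← sq_abs, hσ, one_pow]
    have hφ : Measurable fun t => σ * ((kernelTerm R u x t).re - e) :=
      ((hgc.sub continuous_const).const_mul σ).measurable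
    have hWm : ∀ k, Measurable fun ω => σ * ((kernelTerm R u x (X k ω)).re - e) :=
      fun k => hφ.comp (hX.1 k)
    have hWb : ∀ k ω, |σ * ((kernelTerm R u x (X k ω)).re - e)| ≤ 2 * b := fun k ω => by
      rw [abs_mul, hσ, one_mul]
      exact (abs_sub _ _).trans (by linarith [hgb (X k ω)])
    have hgi : ∀ k, Integrable (fun ω => (kernelTerm R u x (X k ω)).re) P := fun k =>
      Integrable.of_bound (hgc.measurable.comp (hX.1 k)).aestronglyMeasurable b
        (.of_forall fun ω => hgb _)
    have hg2i : ∀ k, Integrable (fun ω => (kernelTerm R u x (X k ω)).re ^ 2) P := fun k => by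
      refine Integrable.of_bound ((hgc.measurable.comp (hX.1 k)).pow_const 2).aestronglyMeasurable
        (b ^ 2) (.of_forall fun ω => ?_)
      rw [norm_pow, Real.norm_eq_abs]
      exact pow_le_pow_left₀ (abs_nonneg _) (hgb _) 2
    have hge : ∀ k, ∫ ω, (kernelTerm R u x (X k ω)).re ∂P = e := fun k => by
      rw [he', integral_comp_sample hp hX k hgc]
      simp
    have hg2 : ∀ k, ∫ ω, (kernelTerm R u x (X k ω)).re ^ 2 ∂P ≤ v := fun k => by
      rw [integral_comp_sample hp hX k (g := fun t => (kernelTerm R u x t).re ^ 2) (hgc.pow 2)]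
      refine le_trans (integral_mono_of_nonneg (.of_forall fun t => ?_) ?_ (.of_forall fun t => ?_))
        (integral_sq_norm_kernelTerm_mul_le hR u x hp hF hM)
      · exact mul_nonneg (sq_nonneg _) (hp.1 t)
      · refine (hp.2.1.norm.const_mul (b ^ 2)).mono'
          ((hGc.norm.pow 2).aestronglyMeasurable.mul hp.2.1.1) (.of_forall fun t => ?_)
        rw [norm_mul, norm_pow, norm_norm]
        exact mul_le_mul_of_nonneg_right
          (pow_le_pow_left₀ (norm_nonneg _) (norm_kernelTerm_le hR u x t) 2) (norm_nonneg _)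
      · refine mul_le_mul_of_nonneg_right ?_ (hp.1 t)
        rw [← sq_abs]
        exact pow_le_pow_left₀ (abs_nonneg _) (Complex.abs_re_le_norm _) 2
    refine measure_sum_ge_le_exp (W := fun k ω => σ * ((kernelTerm R u x (X k ω)).re - e)) hWm
      (hX.2.1.comp (fun _ t => σ * ((kernelTerm R u x t).re - e)) fun _ => hφ) hl
      (fun k ω => ?_) (fun k => ?_) (fun k => ?_) (fun k => ?_) (fun k => ?_) τ
    · rw [abs_mul, abs_of_nonneg hl]
      exact (mul_le_mul_of_nonneg_left (hWb k ω) hl).trans hlb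
    · rw [integral_const_mul, integral_sub (hgi k) (integrable_const _), hge]
      simp
    · exact ((hgi k).sub (integrable_const _)).const_mul σ
    · refine Integrable.of_bound ((hWm k).pow_const 2).aestronglyMeasurable ((2 * b) ^ 2)
        (.of_forall fun ω => ?_)
      rw [norm_pow, Real.norm_eq_abs]
      exact pow_le_pow_left₀ (abs_nonneg _) (hWb k ω) 2
    · have : ∀ ω, (σ * ((kernelTerm R u x (X k ω)).re - e)) ^ 2 =
          (kernelTerm R u x (X k ω)).re ^ 2 - 2 * e * (kernelTerm R u x (X k ω)).re + e ^ 2 :=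
        fun ω => by rw [mul_pow, hσ2]; ring
      simp only [this]
      have h1 : Integrable (fun ω => (kernelTerm R u x (X k ω)).re ^ 2 -
          2 * e * (kernelTerm R u x (X k ω)).re) P := (hg2i k).sub ((hgi k).const_mul _)
      rw [integral_add h1 (integrable_const _), integral_sub (hg2i k) ((hgi k).const_mul _), integral_const_mul, hge]
      simp only [integral_const, probReal_univ, smul_eq_mul, one_mul]
      nlinarith [hg2 k, sq_nonneg e]
  have hsub : {ω | τ ≤ |fluctuation R (fun k => X k ω) p u x|} ⊆
      {ω | n * τ ≤ ∑ k, 1 * ((kernelTerm R u x (X k ω)).re - e)} ∪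
      {ω | n * τ ≤ ∑ k, (-1) * ((kernelTerm R u x (X k ω)).re - e)} := by
    intro ω hω
    have h := fluctuation_eq R hn (fun k => X k ω) hp.2.1 u x
    have hn0 : (0 : ℝ) ≤ n := Nat.cast_nonneg n
    simp only [Set.mem_union, Set.mem_ofPred_eq, one_mul, neg_one_mul,
      Finset.sum_neg_distrib] at hω ⊢
    rw [← h]
    rcases le_abs.1 hω with h1 | h1
    · exact Or.inl (mul_le_mul_of_nonneg_left h1 hn0)
    · refine Or.inr ?_
      rw [← mul_neg]
      exact mul_le_mul_of_nonneg_left h1 hn0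
  refine (measure_mono hsub).trans ((measure_union_le _ _).trans ?_)
  rw [two_mul, ENNReal.ofReal_add (Real.exp_nonneg _) (Real.exp_nonneg _)]
  refine add_le_add ?_ ?_
  · rw [ENNReal.le_ofReal_iff_toReal_le (measure_ne_top _ _) (Real.exp_nonneg _)]
    exact key 1 (by simp)
  · rw [ENNReal.le_ofReal_iff_toReal_le (measure_ne_top _ _) (Real.exp_nonneg _)]
    exact key (-1) (by simp)

/-! ### Taylor expansion of the fluctuation and the net. -/

lemma coordMonomial_append {k : ℕ} (u : Fin m → Fin d) (w : Fin k → Fin d)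
    (s : EuclideanSpace ℝ (Fin d)) :
    coordMonomial (Fin.append u w) s = coordMonomial u s * coordMonomial w s := by
  simp [coordMonomial, Fin.prod_univ_add]

lemma abs_inner_le_of_mem_centeredCube {R : ℝ} {s : EuclideanSpace ℝ (Fin d)}
    (hs : s ∈ centeredCube d R) (h : EuclideanSpace ℝ (Fin d)) :
    |(inner ℝ s h : ℝ)| ≤ d * (R * ‖h‖) := by
  rw [PiLp.inner_apply]
  refine (Finset.abs_sum_le_sum_abs _ _).trans ?_
  refine (Finset.sum_le_sum (g := fun _ => R * ‖h‖) fun j _ => ?_).trans (by simp)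
  simp only [RCLike.inner_apply, conj_trivial, abs_mul]
  rw [mul_comm]
  exact mul_le_mul (hs j) (PiLp.norm_apply_le h j) (abs_nonneg _) ((abs_nonneg _).trans (hs j))

/-- Taylor expansion of a band-limited function. -/
lemma hasSum_synthesis_add {R : ℝ} {ψ : EuclideanSpace ℝ (Fin d) → ℂ} (hψ : Continuous ψ)
    {b : ℝ} (hb : ∀ s, ‖ψ s‖ ≤ b) (u : Fin m → Fin d) (x h : EuclideanSpace ℝ (Fin d)) :
    HasSum (fun k : ℕ => ∑ w : Fin k → Fin d, ((coordMonomial w h : ℝ) / (k.factorial : ℝ) : ℝ) *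
        synthesis (volume.restrict (centeredCube d R)) ψ (Fin.append u w) x)
      (synthesis (volume.restrict (centeredCube d R)) ψ u (x + h)) := by
  set μ := (volume : Measure (EuclideanSpace ℝ (Fin d))).restrict (centeredCube d R)
  set B : ℝ := d * (R * ‖h‖)
  have hint : ∀ {l : ℕ} (v : Fin l → Fin d), Integrable (fun s => Complex.I ^ l *
      (coordMonomial v s : ℂ) * planeWave s x * ψ s) μ := fun v =>
    (Continuous.continuousOn (by fun_prop)).integrableOn_compact (isCompact_centeredCube d R)
  have key : ∀ (k : ℕ) s, Complex.I ^ m * (coordMonomial u s : ℂ) * planeWave s x * ψ s *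
      ((Complex.I * (inner ℝ s h : ℝ)) ^ k / k.factorial) =
      ∑ w : Fin k → Fin d, ((coordMonomial w h : ℝ) / (k.factorial : ℝ) : ℝ) *
        (Complex.I ^ (m + k) * (coordMonomial (Fin.append u w) s : ℂ) * planeWave s x * ψ s) := by
    intro k s
    have h1 : ((inner ℝ s h : ℝ) : ℂ) ^ k =
        ∑ w : Fin k → Fin d, (coordMonomial w s : ℂ) * (coordMonomial w h : ℂ) := by
      rw [PiLp.inner_apply, Complex.ofReal_sum, Fintype.sum_pow]
      refine Finset.sum_congr rfl fun w _ => ?_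
      simp only [coordMonomial, RCLike.inner_apply, conj_trivial]
      push_cast
      rw [Finset.prod_mul_distrib, mul_comm]
    rw [mul_pow, h1, mul_div_assoc, Finset.sum_div, Finset.mul_sum, Finset.mul_sum]
    refine Finset.sum_congr rfl fun w _ => ?_
    rw [coordMonomial_append, pow_add]
    push_cast
    ring
  have main : HasSum (fun k : ℕ => ∫ s, Complex.I ^ m * (coordMonomial u s : ℂ) * planeWave s x *
      ψ s * ((Complex.I * (inner ℝ s h : ℝ)) ^ k / k.factorial) ∂μ)
      (synthesis μ ψ u (x + h)) := by
    refine hasSum_integral_of_dominated_convergence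
      (fun k _ => R ^ m * b * (B ^ k / k.factorial)) (fun k => ?_) (fun k => ?_) ?_ ?_ ?_
    · exact Continuous.aestronglyMeasurable (by fun_prop)
    · refine (ae_restrict_iff' (measurableSet_centeredCube d R)).2 (.of_forall fun s hs => ?_)
      simp only [norm_mul, norm_pow, norm_div, Complex.norm_I, one_pow, one_mul, norm_planeWave,
        mul_one, Complex.norm_real, Real.norm_eq_abs, Complex.norm_natCast]
      have h1 := abs_coordMonomial_le_pow u hs
      have h2 := abs_inner_le_of_mem_centeredCube hs h
      have h3 := (abs_nonneg _).trans h1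
      have h4 : 0 ≤ b := (norm_nonneg _).trans (hb s)
      gcongr
      exact hb s
    · exact .of_forall fun _ => (Real.summable_pow_div_factorial B).mul_left _
    · exact integrable_const _
    · refine .of_forall fun s => ?_
      have h1 : HasSum (fun k : ℕ => (Complex.I * (inner ℝ s h : ℝ)) ^ k / (k.factorial : ℂ))
          (planeWave s h) := by
        rw [planeWave, Complex.exp_eq_exp_ℂ]
        exact NormedSpace.expSeries_div_hasSum_exp _
      have h2 := h1.mul_left (Complex.I ^ m * (coordMonomial u s : ℂ) * planeWave s x * ψ s)
      have e : Complex.I ^ m * (coordMonomial u s : ℂ) * planeWave s (x + h) * ψ s =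
          Complex.I ^ m * (coordMonomial u s : ℂ) * planeWave s x * ψ s * planeWave s h := by
        rw [planeWave_add]; ring
      rw [e]
      exact h2
  refine main.congr_fun ?_
  intro k
  simp only [key]
  rw [integral_finsetSum _ fun w _ => (hint (Fin.append u w)).const_mul _]
  simp only [integral_const_mul, synthesis]

/-- Bounds on all derivatives at a point control the fluctuation at distance `1/R`. -/
lemma abs_fluctuation_add_le {R T : ℝ} (hR : 0 < R) (X : Fin n → EuclideanSpace ℝ (Fin d))
    {p : EuclideanSpace ℝ (Fin d) → ℝ} (hp : IsProbDensity p) (u : Fin m → Fin d)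
    {x h : EuclideanSpace ℝ (Fin d)} (hh : ∀ j, |h j| ≤ R⁻¹)
    (hT : ∀ (k : ℕ) (w : Fin k → Fin d),
      |fluctuation R X p (Fin.append u w) x| ≤ R ^ k * ((k + 1) * T)) :
    |fluctuation R X p u (x + h)| ≤ T * Real.exp (2 * d) := by
  have hT0 : 0 ≤ T := by
    have := (abs_nonneg _).trans (hT 0 Fin.elim0)
    simpa using this
  have hψ : Continuous fun s => (inversionConst d : ℂ) * (empiricalFourier X s - angularFourier p s) :=
    continuous_const.mul ((continuous_empiricalFourier X).sub (continuous_angularFourier hp.2.1))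
  have hb : ∀ s, ‖(inversionConst d : ℂ) * (empiricalFourier X s - angularFourier p s)‖ ≤
      inversionConst d * 2 := fun s => by
    rw [norm_mul, Complex.norm_real, Real.norm_eq_abs, abs_of_pos (inversionConst_pos d)]
    refine mul_le_mul_of_nonneg_left ?_ (inversionConst_pos d).le
    refine (norm_sub_le _ _).trans ?_
    linarith [norm_empiricalFourier_le X s, norm_angularFourier_le hp s]
  have hs := Complex.hasSum_re (hasSum_synthesis_add (R := R) hψ hb u x h)
  simp only [Complex.re_sum, Complex.re_ofReal_mul] at hs
  have he : HasSum (fun k : ℕ => T * ((2 * d : ℝ) ^ k / k.factorial)) (T * Real.exp (2 * d)) := by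
    rw [Real.exp_eq_exp_ℝ]
    exact (NormedSpace.expSeries_div_hasSum_exp (2 * d : ℝ)).mul_left T
  have hk : ∀ k : ℕ, ‖∑ w : Fin k → Fin d, coordMonomial w h / (k.factorial : ℝ) *
      (synthesis (volume.restrict (centeredCube d R)) (fun s => (inversionConst d : ℂ) *
        (empiricalFourier X s - angularFourier p s)) (Fin.append u w) x).re‖ ≤
      T * ((2 * d : ℝ) ^ k / k.factorial) := by
    intro k
    have hterm : ∀ w : Fin k → Fin d, ‖coordMonomial w h / (k.factorial : ℝ) *
        (synthesis (volume.restrict (centeredCube d R)) (fun s => (inversionConst d : ℂ) *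
        (empiricalFourier X s - angularFourier p s)) (Fin.append u w) x).re‖ ≤
        (2 ^ k * T) / k.factorial := fun w => by
      rw [norm_mul, norm_div, Real.norm_eq_abs, Real.norm_eq_abs, Real.norm_eq_abs, Nat.abs_cast]
      -- The increment `h` lies in the cube of half-width `R⁻¹`, so the monomial bound applies to
      -- it; this cancels the `R ^ k` in `hT`.
      have h1 : |coordMonomial w h| ≤ R⁻¹ ^ k := abs_coordMonomial_le_pow w hh
      have h2 := hT k w
      have h3 : ((k : ℝ) + 1) ≤ 2 ^ k := by exact_mod_cast Nat.lt_two_pow_self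
      calc _ ≤ R⁻¹ ^ k / k.factorial * (R ^ k * ((k + 1) * T)) := by gcongr; exact h2
        _ = (R⁻¹ * R) ^ k * ((k + 1) * T) / k.factorial := by rw [mul_pow]; ring
        _ = ((k + 1) * T) / k.factorial := by rw [inv_mul_cancel₀ hR.ne', one_pow, one_mul]
        _ ≤ _ := by gcongr
    refine (norm_sum_le _ _).trans ((Finset.sum_le_sum fun w _ => hterm w).trans (le_of_eq ?_))
    simp only [Finset.sum_const, Finset.card_univ, Fintype.card_fun, Fintype.card_fin, nsmul_eq_mul]
    push_cast
    rw [mul_pow]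
    ring
  rw [fluctuation, ← Real.norm_eq_abs, ← hs.tsum_eq]
  exact tsum_of_norm_bounded he hk

/-- A bounded set is covered by `O(R^d)` cubes of half-width `1/R`. -/
lemma exists_net {S : Set (EuclideanSpace ℝ (Fin d))} (hS : Bornology.IsBounded S) {D R : ℝ}
    (hD : 0 ≤ D) (hdiam : Metric.diam S ≤ D) (hR : 1 ≤ R) :
    ∃ G : Finset (EuclideanSpace ℝ (Fin d)), (G.card : ℝ) ≤ ((2 * D + 3) * R) ^ d ∧
      ∀ x ∈ S, ∃ z ∈ G, ∀ j, |(x - z) j| ≤ R⁻¹ := by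
  classical
  have hR0 : 0 < R := by linarith
  rcases S.eq_empty_or_nonempty with rfl | ⟨x₀, hx₀⟩
  · exact ⟨∅, by simp; positivity, by simp⟩
  -- The net is a grid of step `1 / R` around a point of `S`, not necessarily inside `S`. Its side
  -- has `2 * N + 1 ≤ 2 * D * R + 3` points, which is at most `(2 * D + 3) * R` because `R ≥ 1`.
  set N : ℤ := ⌈D * R⌉ with hN
  have hN0 : 0 ≤ N := Int.ceil_nonneg (by positivity)
  set pt : (Fin d → ℤ) → EuclideanSpace ℝ (Fin d) :=
    fun z => WithLp.toLp 2 fun j => x₀ j + z j / R with hpt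
  refine ⟨(Fintype.piFinset fun _ : Fin d => Finset.Icc (-N) N).image pt, ?_, fun x hx => ?_⟩
  · have h1 : (((Fintype.piFinset fun _ : Fin d => Finset.Icc (-N) N).image pt).card : ℝ) ≤
        ((Fintype.piFinset fun _ : Fin d => Finset.Icc (-N) N).card : ℝ) := by
      exact_mod_cast Finset.card_image_le
    refine h1.trans ?_
    rw [Fintype.card_piFinset_const, Int.card_Icc]
    push_cast
    have h2 : (((N + 1 - -N).toNat : ℕ) : ℝ) = 2 * N + 1 := by
      have : (((N + 1 - -N).toNat : ℕ) : ℤ) = 2 * N + 1 := by omega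
      exact_mod_cast this
    rw [h2]
    have h3 : (N : ℝ) < D * R + 1 := Int.ceil_lt_add_one _
    have h4 : (0 : ℝ) ≤ N := by exact_mod_cast hN0
    exact pow_le_pow_left₀ (by linarith) (by nlinarith) d
  · have hdist : ∀ j, |x j - x₀ j| ≤ D := fun j => by
      have h1 : |(x - x₀) j| ≤ ‖x - x₀‖ := PiLp.norm_apply_le (x - x₀) j
      rw [← dist_eq_norm] at h1
      exact h1.trans ((Metric.dist_le_diam_of_mem hS hx hx₀).trans hdiam)
    refine ⟨pt fun j => ⌊(x j - x₀ j) * R⌋, Finset.mem_image_of_mem _ ?_, fun j => ?_⟩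
    · rw [Fintype.mem_piFinset]
      intro j
      have h1 := abs_le.1 (hdist j)
      rw [Finset.mem_Icc]
      constructor
      · rw [Int.le_floor]
        push_cast
        have : D * R ≤ N := Int.le_ceil _
        nlinarith
      · refine (Int.floor_le_ceil _).trans (Int.ceil_le_ceil ?_)
        exact mul_le_mul_of_nonneg_right h1.2 hR0.le
    · have e : (x - pt fun j => ⌊(x j - x₀ j) * R⌋) j = Int.fract ((x j - x₀ j) * R) * R⁻¹ := by
        simp only [hpt, PiLp.sub_apply, Int.fract]
        field_simp
        ring
      rw [e, abs_of_nonneg (mul_nonneg (Int.fract_nonneg _) (by positivity))]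
      exact mul_le_of_le_one_left (by positivity) (Int.fract_lt_one _).le

/-! ### The uniform deviation inequality. -/

/-- Choice of the level in the union bound. -/
lemma exp_neg_level_le {G R δ : ℝ} (hG : 1 ≤ G) (hR : 2 ≤ R) (hδ : 0 < δ) (hδ1 : δ < 1) :
    G * R ^ d * Real.exp (-(((d + 1) / Real.log 2 + Real.log G / Real.log 2 ^ 2) *
      (Real.log R * Real.log (2 / δ)))) ≤ δ := by
  have h2 : 0 < Real.log 2 := Real.log_pos one_lt_two
  have hR0 : 0 < R := by linarith
  have ha : Real.log 2 ≤ Real.log R := Real.log_le_log two_pos hR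
  have hb : Real.log 2 ≤ Real.log (2 / δ) := by
    apply Real.log_le_log two_pos
    rw [le_div_iff₀ hδ]
    linarith
  set a := Real.log R with ha'
  set b := Real.log (2 / δ) with hb'
  have hG0 : 0 ≤ Real.log G := Real.log_nonneg hG
  -- Both logarithms are at least `log 2`, so each is bounded by a multiple of their product. This
  -- is where `R ≥ 2` matters.
  have e1 : a ≤ a * b / Real.log 2 := by
    rw [le_div_iff₀ h2]
    exact mul_le_mul_of_nonneg_left hb (by linarith)
  have e2 : b ≤ a * b / Real.log 2 := by
    rw [le_div_iff₀ h2, mul_comm]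
    exact mul_le_mul_of_nonneg_right ha (by linarith)
  have e3 : Real.log G ≤ Real.log G * (a * b / Real.log 2 ^ 2) := by
    refine le_mul_of_one_le_right hG0 ?_
    rw [le_div_iff₀ (by positivity)]
    nlinarith
  have e4 : d * a + b + Real.log G ≤
      ((d + 1) / Real.log 2 + Real.log G / Real.log 2 ^ 2) * (a * b) := by
    have : ((d + 1) / Real.log 2 + Real.log G / Real.log 2 ^ 2) * (a * b) =
      d * (a * b / Real.log 2) + a * b / Real.log 2 + Real.log G * (a * b / Real.log 2 ^ 2) := by
      ring
    rw [this]
    gcongr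
  calc _ ≤ G * R ^ d * Real.exp (-(d * a + b + Real.log G)) := by gcongr
    _ = δ / 2 := by
      have hexp : Real.exp (d * a + b + Real.log G) = R ^ d * (2 / δ) * G := by
        rw [Real.exp_add, Real.exp_add, Real.exp_nat_mul, Real.exp_log (by linarith : 0 < G),
          Real.exp_log (by positivity : 0 < 2 / δ), Real.exp_log hR0]
      rw [Real.exp_neg, hexp]
      field_simp
    _ ≤ δ := by linarith

set_option maxHeartbeats 1000000 in
/-- Uniform deviation inequality: the fluctuation of all derivatives of order `i ≤ r` over a set of
diameter at most `D`. -/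
theorem exists_measure_sup_fluctuation_gt_le (d r : ℕ) (hd : 1 ≤ d) {D K M : ℝ} (hD : 0 ≤ D)
    (hK : 0 < K) (hM : 0 ≤ M) :
    ∃ C : ℝ, 0 < C ∧ ∀ (S : Set (EuclideanSpace ℝ (Fin d))) (p : EuclideanSpace ℝ (Fin d) → ℝ),
      Bornology.IsBounded S → Metric.diam S ≤ D → IsProbDensity p →
      Integrable (angularFourier p) → ∫ s, ‖angularFourier p s‖ ≤ M →
      ∀ (Ω : Type*) [MeasurableSpace Ω] (P : Measure Ω) [IsProbabilityMeasure P]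
        (n : ℕ) (X : Fin n → Ω → EuclideanSpace ℝ (Fin d)) (i : ℕ) (R δ : ℝ),
        1 ≤ n → IsIIDSample P p X → i ≤ r → 2 ≤ R → 0 < δ → δ < 1 →
        R ^ d * Real.log R * Real.log (2 / δ) ≤ K * n →
        P {ω | ∃ x ∈ S, ∃ u : Fin i → Fin d,
          C * Real.sqrt (R ^ (d + 2 * i) * Real.log R * Real.log (2 / δ) / n) <
            |fluctuation R (fun k => X k ω) p u x|} ≤ ENNReal.ofReal δ := by
  have h2 : 0 < Real.log 2 := Real.log_pos one_lt_two
  have hd1 : (1 : ℝ) ≤ d := by exact_mod_cast hd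
  set c := inversionConst d with hc
  have hc0 : 0 < c := inversionConst_pos d
  -- The factor `4` covers the two tails and the halving that makes room for the geometric series.
  -- The exponent `r + 1` bounds `d ^ i` and also `d` itself.
  set G : ℝ := 4 * d ^ (r + 1) * (2 * D + 3) ^ d with hG
  have hG1 : 1 ≤ G := by
    have h3 : (1 : ℝ) ≤ d ^ (r + 1) := one_le_pow₀ hd1
    have h4 : (1 : ℝ) ≤ (2 * D + 3) ^ d := one_le_pow₀ (by linarith)
    nlinarith [mul_le_mul h3 h4 zero_le_one (by positivity)]
  set c₀ : ℝ := (d + 1) / Real.log 2 + Real.log G / Real.log 2 ^ 2 with hc₀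
  have hc₀0 : 0 < c₀ := by
    have := Real.log_nonneg hG1
    positivity
  -- Dividing the Chernoff parameter by `κ` makes its product with the sup bound of the centered
  -- terms at most `1`.
  set κ : ℝ := 1 + 2 * c * 2 ^ d * Real.sqrt (c₀ * K) with hκ
  have hκ1 : 1 ≤ κ := by
    have : 0 ≤ 2 * c * 2 ^ d * Real.sqrt (c₀ * K) := by positivity
    linarith
  set V : ℝ := c ^ 2 * 2 ^ d * M with hV
  have hV0 : 0 ≤ V := by positivity
  refine ⟨κ * (V + 1) * Real.sqrt c₀ * Real.exp (2 * d), by positivity, ?_⟩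
  intro S p hS hdiam hp hF hFM Ω _ P _ n X i R δ hn hX hi hR hδ hδ1 hKn
  have hR0 : 0 < R := by linarith
  have hn0 : (0 : ℝ) < n := by exact_mod_cast hn
  have ha : 0 < Real.log R := Real.log_pos (by linarith)
  have hb : 0 < Real.log (2 / δ) := Real.log_pos (by rw [lt_div_iff₀ hδ]; linarith)
  set ab := Real.log R * Real.log (2 / δ) with hab
  have hab0 : 0 < ab := by positivity
  set l := c₀ * ab with hl
  have hl0 : 0 < l := by positivity
  -- Chosen so that `n * q ^ 2 * R ^ d = l`: the variance term of the exponent becomes a multiple of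
  -- `l`, and the hypothesis on `n` bounds `q * R ^ d`.
  set q := Real.sqrt (l / (n * R ^ d)) with hq
  have hq0 : 0 ≤ q := Real.sqrt_nonneg _
  have hq2 : q ^ 2 * (n * R ^ d) = l := by
    rw [hq, Real.sq_sqrt (by positivity)]
    field_simp
  have hqR : q * R ^ d ≤ Real.sqrt (c₀ * K) := by
    apply Real.le_sqrt_of_sq_le
    have : (q * R ^ d) ^ 2 * n ≤ c₀ * K * n := by
      calc (q * R ^ d) ^ 2 * n = (q ^ 2 * (n * R ^ d)) * R ^ d := by ring
        _ = c₀ * (R ^ d * Real.log R * Real.log (2 / δ)) := by rw [hq2, hl, hab]; ring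
        _ ≤ c₀ * (K * n) := by gcongr
        _ = _ := by ring
    exact le_of_mul_le_mul_right this hn0
  set T := κ * (V + 1) * (R ^ (i + d) * q) with hT
  have hlevel : G * R ^ d * Real.exp (-l) ≤ δ := exp_neg_level_le hG1 hR hδ hδ1
  obtain ⟨net, hcard, hnet⟩ := exists_net hS hD hdiam (by linarith : (1 : ℝ) ≤ R)
  have hpoint : ∀ (k : ℕ) (w : Fin (i + k) → Fin d) (z : EuclideanSpace ℝ (Fin d)),
      P {ω | R ^ k * ((k + 1) * T) ≤ |fluctuation R (fun k => X k ω) p w z|} ≤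
        ENNReal.ofReal (2 * Real.exp (-((k + 1) * l))) := by
    intro k w z
    refine (measure_abs_fluctuation_ge_le hp hX hn hF hFM hR0.le
      (l := q / (κ * R ^ (i + k))) (by positivity) w z ?_ _).trans
      (ENNReal.ofReal_le_ofReal ?_)
    · calc q / (κ * R ^ (i + k)) * (2 * (c * R ^ (i + k) * (2 * R) ^ d))
          = 2 * c * 2 ^ d * (q * R ^ d) / κ := by rw [mul_pow]; field_simp
        _ ≤ 1 := by
          rw [div_le_one (by linarith), hκ]
          have : 2 * c * 2 ^ d * (q * R ^ d) ≤ 2 * c * 2 ^ d * Real.sqrt (c₀ * K) := by gcongr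
          linarith
    · gcongr
      have e1 : n * ((q / (κ * R ^ (i + k))) ^ 2 * ((c * R ^ (i + k)) ^ 2 * (2 * R) ^ d * M)) =
          V * l / κ ^ 2 := by
        rw [← hq2, hV, mul_pow 2 R]
        field_simp
      -- The factor `V + 1` in `T` pays for the variance term `V * l` and leaves at least `(k + 1) *
      -- l`.
      have e2 : n * (q / (κ * R ^ (i + k)) * (R ^ k * ((k + 1) * T))) = (k + 1) * (V + 1) * l := by
        rw [← hq2, hT, pow_add, pow_add]
        field_simp
      rw [mul_sub, e1, e2]
      have e3 : V * l / κ ^ 2 ≤ V * l := div_le_self (by positivity) (one_le_pow₀ hκ1)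
      have e4 : 0 ≤ (k : ℝ) * (V * l) := by positivity
      have e5 : (k + 1) * (V + 1) * l = k * (V * l) + V * l + (k + 1) * l := by ring
      rw [e5]
      linarith
  have hTC : T * Real.exp (2 * d) = κ * (V + 1) * Real.sqrt c₀ * Real.exp (2 * d) *
      Real.sqrt (R ^ (d + 2 * i) * Real.log R * Real.log (2 / δ) / n) := by
    have : R ^ (i + d) * q = Real.sqrt c₀ *
        Real.sqrt (R ^ (d + 2 * i) * Real.log R * Real.log (2 / δ) / n) := by
      rw [← Real.sqrt_mul hc₀0.le, hq, ← Real.sqrt_sq (by positivity : 0 ≤ R ^ (i + d)),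
        ← Real.sqrt_mul (by positivity)]
      congr 1
      rw [hl, hab, pow_add, pow_add, pow_mul' R 2 i]
      field_simp
    rw [hT, this]
    ring
  have hsub : {ω | ∃ x ∈ S, ∃ u : Fin i → Fin d,
      κ * (V + 1) * Real.sqrt c₀ * Real.exp (2 * d) *
        Real.sqrt (R ^ (d + 2 * i) * Real.log R * Real.log (2 / δ) / n) <
          |fluctuation R (fun k => X k ω) p u x|} ⊆
      ⋃ k : ℕ, ⋃ w : Fin (i + k) → Fin d, ⋃ z ∈ net,
        {ω | R ^ k * ((k + 1) * T) ≤ |fluctuation R (fun k => X k ω) p w z|} := by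
    rintro ω ⟨x, hx, u, hu⟩
    by_contra hcon
    simp only [Set.mem_iUnion, Set.mem_ofPred_eq, not_exists, not_le] at hcon
    obtain ⟨z, hz, hxz⟩ := hnet x hx
    have := abs_fluctuation_add_le hR0 (fun k => X k ω) hp u (x := z) (h := x - z) (T := T) hxz
      fun k w => (hcon k (Fin.append u w) z hz).le
    rw [add_sub_cancel, hTC] at this
    linarith
  have hstep : ∀ k : ℕ, P (⋃ w : Fin (i + k) → Fin d, ⋃ z ∈ net,
      {ω | R ^ k * ((k + 1) * T) ≤ |fluctuation R (fun k => X k ω) p w z|}) ≤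
      ENNReal.ofReal (δ / 2 * (1 / 2) ^ k) := by
    intro k
    calc _ ≤ ∑ _w : Fin (i + k) → Fin d, ∑ _z ∈ net,
          ENNReal.ofReal (2 * Real.exp (-((k + 1) * l))) := by
          refine (measure_iUnion_fintype_le _ _).trans (Finset.sum_le_sum fun w _ => ?_)
          exact (measure_biUnion_finset_le _ _).trans (Finset.sum_le_sum fun z _ => hpoint k w z)
      _ = ENNReal.ofReal (d ^ (i + k) * (net.card * (2 * Real.exp (-((k + 1) * l))))) := by
          simp only [Finset.sum_const, Finset.card_univ, Fintype.card_fun, Fintype.card_fin]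
          rw [← ENNReal.ofReal_nsmul, ← ENNReal.ofReal_nsmul, nsmul_eq_mul, nsmul_eq_mul]
          push_cast
          rfl
      _ ≤ _ := by
          refine ENNReal.ofReal_le_ofReal ?_
          have e1 : Real.exp (-((k + 1) * l)) = Real.exp (-l) * Real.exp (-l) ^ k := by
            rw [← Real.exp_nat_mul, ← Real.exp_add]; ring_nf
          have hdr : (d : ℝ) ^ i ≤ d ^ (r + 1) := pow_le_pow_right₀ hd1 (by omega)
          -- Each further order multiplies the number of words by `d` and the probability by `exp
          -- (-l)`; a ratio of at most `1 / 2` makes the sum over orders converge to `δ`.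
          have hdle : (d : ℝ) * Real.exp (-l) ≤ 1 / 2 := by
            have h3 : (d : ℝ) ≤ d ^ (r + 1) := le_self_pow₀ hd1 (by omega)
            have h4 : (1 : ℝ) ≤ (2 * D + 3) ^ d := one_le_pow₀ (by linarith)
            have h5 : (1 : ℝ) ≤ R ^ d := one_le_pow₀ (by linarith)
            have h6 : 2 * (d : ℝ) ≤ G * R ^ d := by
              calc 2 * (d : ℝ) ≤ 4 * d := by linarith
                _ = 4 * d * 1 * 1 := by ring
                _ ≤ G * R ^ d := by rw [hG]; gcongr
            have h7 : 2 * (d : ℝ) * Real.exp (-l) ≤ 1 :=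
              ((mul_le_mul_of_nonneg_right h6 (Real.exp_nonneg _)).trans hlevel).trans hδ1.le
            linarith
          calc (d : ℝ) ^ (i + k) * (net.card * (2 * Real.exp (-((k + 1) * l))))
              = (2 * d ^ i * net.card * Real.exp (-l)) * (d * Real.exp (-l)) ^ k := by
                rw [e1, pow_add, mul_pow]; ring
            _ ≤ (2 * d ^ (r + 1) * ((2 * D + 3) * R) ^ d * Real.exp (-l)) * (1 / 2) ^ k := by
                gcongr
            _ = (G * R ^ d * Real.exp (-l)) / 2 * (1 / 2) ^ k := by rw [hG, mul_pow]; ring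
            _ ≤ _ := by gcongr
  refine (measure_mono hsub).trans ((measure_iUnion_le _).trans ?_)
  refine (ENNReal.tsum_le_tsum hstep).trans (le_of_eq ?_)
  rw [← ENNReal.ofReal_tsum_of_nonneg (fun k => by positivity) (summable_geometric_two.mul_left _),
    tsum_mul_left, tsum_geometric_two]
  congr 1
  ring

/-! ### From the fluctuation and the bias to the uniform error. -/

/-- A deterministic bound from the volume of the cube, used for `R < 2`, where the probabilistic
estimate is not available. -/
lemma abs_fluctuation_le {R : ℝ} (hR : 0 ≤ R) (X : Fin n → EuclideanSpace ℝ (Fin d))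
    {p : EuclideanSpace ℝ (Fin d) → ℝ} (hp : IsProbDensity p) (u : Fin m → Fin d)
    (x : EuclideanSpace ℝ (Fin d)) :
    |fluctuation R X p u x| ≤ R ^ m * (inversionConst d * 2) * (2 * R) ^ d := by
  refine (Complex.abs_re_le_norm _).trans ?_
  rw [synthesis, ← volume_real_centeredCube hR]
  refine norm_setIntegral_le_of_norm_le_const (isCompact_centeredCube d R).measure_lt_top
    fun s hs => ?_
  simp only [norm_mul, norm_pow, Complex.norm_I, one_pow, one_mul, norm_planeWave, mul_one,
    Complex.norm_real, Real.norm_eq_abs, abs_of_pos (inversionConst_pos d)]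
  have h1 : ‖empiricalFourier X s - angularFourier p s‖ ≤ 2 := by
    refine (norm_sub_le _ _).trans ?_
    linarith [norm_empiricalFourier_le X s, norm_angularFourier_le hp s]
  have := inversionConst_pos d
  have h2 := abs_coordMonomial_le_pow u hs
  gcongr

/-- Regularity at a point spreads to a neighbourhood, which is needed because Fourier inversion must
hold near `x` before it can be differentiated there. -/
lemma MemCr.eventually_continuousAt {r : ℕ} {S : Set (EuclideanSpace ℝ (Fin d))}
    {p : EuclideanSpace ℝ (Fin d) → ℝ} (h : MemCr r S p) {x : EuclideanSpace ℝ (Fin d)}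
    (hx : x ∈ S) : ∀ᶠ y in nhds x, ContinuousAt p y :=
  ((h.1 x hx).eventually (by simp)).mono fun _ hy => hy.continuousAt

/-- If the uniform error exceeds a level, so does the fluctuation, after removal of the bias. -/
lemma exists_lt_abs_fluctuation {R : ℝ} (hR : 0 < R) (X : Fin n → EuclideanSpace ℝ (Fin d))
    {S : Set (EuclideanSpace ℝ (Fin d))} {p : EuclideanSpace ℝ (Fin d) → ℝ} (hp : Integrable p)
    {i : ℕ} (hF : ∀ k ≤ i, Integrable fun s => ‖s‖ ^ k * ‖angularFourier p s‖)
    (hS : ∀ x ∈ S, ∀ᶠ y in nhds x, ContinuousAt p y) {a b e : ℝ} (ha : 0 ≤ a) (hb : 0 ≤ b)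
    (hbias : ∀ u : Fin i → Fin d, inversionConst d *
      ∫ s in (centeredCube d R)ᶜ, |coordMonomial u s| * ‖angularFourier p s‖ ≤ b)
    (he : a + b < e) (hsup : ENNReal.ofReal e ≤ supGradError i S (fourierEstimator R X) p) :
    ∃ x ∈ S, ∃ u : Fin i → Fin d, a < |fluctuation R X p u x| := by
  by_contra! hcon
  have h : supGradError i S (fourierEstimator R X) p ≤ ENNReal.ofReal (a + b) := by
    refine iSup₂_le fun x hx => ?_
    rw [← ofReal_norm]
    refine ENNReal.ofReal_le_ofReal ((pi_norm_le_iff_of_nonneg (by positivity)).2 fun u => ?_)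
    exact (abs_gradTensor_sub_le hR X hp hF (hS x hx) u).trans
      (add_le_add (hcon x hx u) (hbias u))
  exact absurd (hsup.trans h) (not_le.2 (ENNReal.ofReal_lt_ofReal_iff'.2 ⟨he, by linarith⟩))

lemma integrable_of_even_of_tail {f g : ℝ → ℝ} (hf : ∀ t, f (-t) = f t) (hc : Continuous f)
    (hfg : ∀ t, 0 < t → f t = g t) {R : ℝ} (hR : 0 ≤ R) (hi : IntegrableOn g (Set.Ioi R)) :
    Integrable f ∧ ∫ t in {t | R < |t|}, f t = 2 * ∫ t in Set.Ioi R, g t := by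
  have hi' : IntegrableOn f (Set.Ioi R) :=
    hi.congr_fun (fun t ht => (hfg t (hR.trans_lt ht)).symm) measurableSet_Ioi
  refine ⟨integrable_of_even hf ?_, ?_⟩
  · rw [← Set.Ioc_union_Ioi_eq_Ioi hR]
    exact (hc.integrableOn_Ioc).union hi'
  · rw [setIntegral_abs_gt_of_even hf hR hi',
      setIntegral_congr_fun measurableSet_Ioi fun t ht => hfg t (hR.trans_lt ht)]

/-- Moments and tails of the supersmooth envelope. -/
lemma supersmooth_envelope {α c : ℝ} (hα : 0 < α) (hc : 0 < c) (k i : ℕ) (hki : k ≤ i)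
    {R : ℝ} (hR : 1 ≤ R) (hRc : 2 * max (1 + (i : ℝ) - α) 0 ≤ c * α * R ^ α) :
    Integrable (fun t : ℝ => |t| ^ k * Real.exp (-c * |t| ^ α)) ∧
    ∫ t in {t : ℝ | R < |t|}, |t| ^ k * Real.exp (-c * |t| ^ α) ≤
      4 / (c * α) * (R ^ max (1 + (i : ℝ) - α) 0 * Real.exp (-c * R ^ α)) := by
  obtain ⟨h1, h2⟩ := integral_Ioi_pow_mul_exp_le hα hc k i hki hR hRc
  obtain ⟨h3, h4⟩ := integrable_of_even_of_tail
    (f := fun t : ℝ => |t| ^ k * Real.exp (-c * |t| ^ α)) (fun t => by simp)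
    ((continuous_abs.pow k).mul (Real.continuous_exp.comp
      ((continuous_abs.rpow_const fun _ => Or.inr hα.le).const_mul (-c))))
    (fun t ht => by simp only [abs_of_pos ht]) (by linarith) h1
  refine ⟨h3, h4.trans_le ?_⟩
  calc _ ≤ 2 * (2 / (c * α) * (R ^ max (1 + (i : ℝ) - α) 0 * Real.exp (-c * R ^ α))) := by gcongr
    _ = _ := by ring

/-- Moments and tails of the ordinary smooth envelope. -/
lemma ordinarySmooth_envelope {β : ℝ} (k : ℕ) (hβ : (k : ℝ) + 1 < β) {R : ℝ} (hR : 1 ≤ R) :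
    Integrable (fun t : ℝ => |t| ^ k * (1 / (1 + |t| ^ β))) ∧
    ∫ t in {t : ℝ | R < |t|}, |t| ^ k * (1 / (1 + |t| ^ β)) ≤
      2 * (R ^ ((k : ℝ) + 1 - β) / (β - k - 1)) := by
  obtain ⟨h1, h2⟩ := integral_Ioi_pow_div_le k hβ hR
  have hβ0 : 0 ≤ β := by
    have : (0 : ℝ) ≤ k := Nat.cast_nonneg k
    linarith
  obtain ⟨h3, h4⟩ := integrable_of_even_of_tail
    (f := fun t : ℝ => |t| ^ k * (1 / (1 + |t| ^ β))) (fun t => by simp)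
    ((continuous_abs.pow k).mul (continuous_const.div
      (continuous_const.add (continuous_abs.rpow_const fun _ => Or.inr hβ0))
      fun t => by positivity))
    (fun t ht => by simp only [abs_of_pos ht]) (by linarith) h1
  exact ⟨h3, h4.trans_le (by gcongr)⟩

/-- The sum of the moments dominates each one, so a single `M` serves all orders up to `r`. -/
lemma exists_moment_bound (h : ℝ → ℝ) (h0 : ∀ t, 0 ≤ h t) (r : ℕ) :
    ∃ M : ℝ, 0 ≤ M ∧ ∀ k ≤ r, ∫ t, |t| ^ k * h t ≤ M := by
  have hnn : ∀ k : ℕ, 0 ≤ ∫ t, |t| ^ k * h t := fun k =>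
    integral_nonneg fun t => mul_nonneg (by positivity) (h0 t)
  refine ⟨∑ k ∈ Finset.range (r + 1), ∫ t, |t| ^ k * h t, Finset.sum_nonneg fun k _ => hnn k,
    fun k hk => ?_⟩
  exact Finset.single_le_sum (f := fun k => ∫ t, |t| ^ k * h t) (fun k _ => hnn k)
    (Finset.mem_range.2 (by omega))

/-- Deviation bound for the uniform error under an envelope for the characteristic function, with
the bias controlled by the tails of the envelope. -/
theorem exists_measure_supGradError_ge_le (d r : ℕ) (hd : 1 ≤ d) {D K A : ℝ} (hD : 0 ≤ D)
    (hK : 0 < K) (hA : 0 < A) {h : ℝ → ℝ} (h0 : ∀ t, 0 ≤ h t)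
    (hint : ∀ k ≤ r, Integrable fun t => |t| ^ k * h t) :
    ∃ C₁ C₂ : ℝ, 0 < C₁ ∧ 0 ≤ C₂ ∧
      ∀ (S : Set (EuclideanSpace ℝ (Fin d))) (p : EuclideanSpace ℝ (Fin d) → ℝ),
      Bornology.IsBounded S → Metric.diam S ≤ D → IsProbDensity p → MemCr r S p →
      (∀ s, ‖angularFourier p s‖ ≤ A * ∏ j, h (s j)) →
      ∀ (Ω : Type*) [MeasurableSpace Ω] (P : Measure Ω) [IsProbabilityMeasure P]
        (n : ℕ) (X : Fin n → Ω → EuclideanSpace ℝ (Fin d)) (i : ℕ) (R δ B : ℝ),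
        1 ≤ n → IsIIDSample P p X → i ≤ r → 0 < R → 0 ≤ B →
        (∀ k ≤ i, ∫ t in {t | R < |t|}, |t| ^ k * h t ≤ B) →
        (∀ a e : ℝ, 0 ≤ a → a + C₂ * B < e →
          {ω | ENNReal.ofReal e ≤ supGradError i S (fourierEstimator R fun k => X k ω) p} ⊆
            {ω | ∃ x ∈ S, ∃ u : Fin i → Fin d, a < |fluctuation R (fun k => X k ω) p u x|}) ∧
        (2 ≤ R → 0 < δ → δ < 1 → R ^ d * Real.log R * Real.log (2 / δ) ≤ K * n → ∀ e : ℝ,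
          C₁ * Real.sqrt (R ^ (d + 2 * i) * Real.log R * Real.log (2 / δ) / n) + C₂ * B < e →
          P {ω | ENNReal.ofReal e ≤ supGradError i S (fourierEstimator R fun k => X k ω) p} ≤
            ENNReal.ofReal δ) := by
  obtain ⟨M, hM0, hM⟩ := exists_moment_bound h h0 r
  obtain ⟨C₁, hC₁, hmain⟩ := exists_measure_sup_fluctuation_gt_le d r hd (M := A * M ^ d) hD hK
    (by positivity)
  have hc := inversionConst_pos d
  refine ⟨C₁, inversionConst d * (A * (d * M ^ (d - 1))), hC₁, by positivity, ?_⟩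
  intro S p hS hdiam hp hr hpA Ω _ P _ n X i R δ B hn hX hi hR hB0 hB
  have hF : ∀ k ≤ i, Integrable fun s => ‖s‖ ^ k * ‖angularFourier p s‖ := fun k hk =>
    integrable_norm_pow_mul_angularFourier hp.2.1 hpA hint (hk.trans hi)
  have hh := hint 0 (Nat.zero_le _)
  have hhM := hM 0 (Nat.zero_le _)
  have hF0 := hF 0 (Nat.zero_le _)
  simp only [pow_zero, one_mul] at hh hhM hF0
  have hFi : Integrable (angularFourier p) :=
    (integrable_norm_iff (continuous_angularFourier hp.2.1).aestronglyMeasurable).1 hF0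
  have hbias : ∀ u : Fin i → Fin d, inversionConst d *
      ∫ s in (centeredCube d R)ᶜ, |coordMonomial u s| * ‖angularFourier p s‖ ≤
      inversionConst d * (A * (d * M ^ (d - 1))) * B := fun u => by
    have := integral_compl_centeredCube_le hA.le hpA h0 u (fun k hk => hint k (hk.trans hi))
      (fun k hk => hM k (hk.trans hi)) hB
    calc _ ≤ inversionConst d * (A * (d * (B * M ^ (d - 1)))) := by gcongr
      _ = _ := by ring
  -- This inclusion holds for every `R > 0` and is kept apart from the probability bound, which
  -- needs `R ≥ 2`. Inclusions suffice because no measurability of the supremum is required.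
  have hsub : ∀ a e : ℝ, 0 ≤ a → a + inversionConst d * (A * (d * M ^ (d - 1))) * B < e →
      {ω | ENNReal.ofReal e ≤ supGradError i S (fourierEstimator R fun k => X k ω) p} ⊆
        {ω | ∃ x ∈ S, ∃ u : Fin i → Fin d, a < |fluctuation R (fun k => X k ω) p u x|} :=
    fun a e ha hae ω hω => exists_lt_abs_fluctuation hR (fun k => X k ω) hp.2.1 hF
      (fun x hx => hr.eventually_continuousAt hx) ha (by positivity) hbias hae hω
  refine ⟨hsub, fun hR2 hδ hδ1 hKn e he => ?_⟩
  exact (measure_mono (hsub _ e (by positivity) he)).trans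
    (hmain S p hS hdiam hp hFi (integral_norm_angularFourier_le hA.le hpA h0 hh hhM)
      Ω P n X i R δ hn hX hi hR2 hδ hδ1 hKn)

end

/-! ### The two smoothness classes. -/

theorem theorem4 (d r : ℕ) (hd : 1 ≤ d) (hr : 1 ≤ r) (D : ℝ) (K : ℝ) (hK : 0 < K) :
    (∀ α A C₁ : ℝ, 0 < α → 0 < A → 0 < C₁ →
      ∃ C R₀ : ℝ, 0 < C ∧ 1 ≤ R₀ ∧
        ∀ (S : Set (EuclideanSpace ℝ (Fin d))) (p₀ : EuclideanSpace ℝ (Fin d) → ℝ),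
          Bornology.IsBounded S → Metric.diam S ≤ D →
          IsProbDensity p₀ → MemCr r S p₀ → IsUpperSupersmooth α A C₁ p₀ →
          ∀ (Ω : Type*) [MeasurableSpace Ω] (P : Measure Ω) [IsProbabilityMeasure P]
            (n : ℕ) (X : Fin n → Ω → EuclideanSpace ℝ (Fin d)) (i : ℕ) (R δ : ℝ),
            1 ≤ n → IsIIDSample P p₀ X → 1 ≤ i → i ≤ r → R₀ ≤ R → 0 < δ → δ < 1 →
            R ^ d * Real.log R * Real.log (2 / δ) ≤ K * n →
            P {ω | ENNReal.ofReal (C * (R ^ (max (1 + (i : ℝ) - α) 0) * Real.exp (-C₁ * R ^ α) +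
                      Real.sqrt (R ^ (d + 2 * i) * Real.log R * Real.log (2 / δ) / n))) ≤
                    supGradError i S (fourierEstimator R (fun k => X k ω)) p₀} ≤
              ENNReal.ofReal δ) ∧
    (∀ β A : ℝ, (r : ℝ) + 1 < β → 0 < A →
      ∃ c : ℝ, 0 < c ∧
        ∀ (S : Set (EuclideanSpace ℝ (Fin d))) (p₀ : EuclideanSpace ℝ (Fin d) → ℝ),
          Bornology.IsBounded S → Metric.diam S ≤ D →
          IsProbDensity p₀ → MemCr r S p₀ → IsUpperOrdinarySmooth β A p₀ →
          ∀ (Ω : Type*) [MeasurableSpace Ω] (P : Measure Ω) [IsProbabilityMeasure P]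
            (n : ℕ) (X : Fin n → Ω → EuclideanSpace ℝ (Fin d)) (i : ℕ) (R δ : ℝ),
            1 ≤ n → IsIIDSample P p₀ X → 1 ≤ i → i ≤ r → 1 ≤ R → 0 < δ → δ < 1 →
            R ^ d * Real.log R * Real.log (2 / δ) ≤ K * n →
            P {ω | ENNReal.ofReal (c * (R ^ (-β + ((i : ℝ) + 1)) +
                      Real.sqrt (R ^ (d + 2 * i) * Real.log R * Real.log (2 / δ) / n))) ≤
                    supGradError i S (fourierEstimator R (fun k => X k ω)) p₀} ≤
              ENNReal.ofReal δ) := by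
  refine ⟨fun α A C₁ hα hA hC₁ => ?_, fun β A hβ hA => ?_⟩
  -- The cutoff at which `C₁ * α * R ^ α` reaches `2 * max (1 + r - α) 0`, as the Laplace-type tail
  -- bound requires.
  · set R₁ : ℝ := (2 * max (1 + (r : ℝ) - α) 0 / (C₁ * α)) ^ α⁻¹ with hR₁
    have hlarge : ∀ i ≤ r, ∀ R, max 2 R₁ ≤ R →
        2 * max (1 + (i : ℝ) - α) 0 ≤ C₁ * α * R ^ α := by
      intro i hi R hR
      have h1 : R₁ ^ α ≤ R ^ α :=
        Real.rpow_le_rpow (by positivity) ((le_max_right _ _).trans hR) hα.le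
      rw [hR₁, Real.rpow_inv_rpow (by positivity) hα.ne', div_le_iff₀ (by positivity)] at h1
      have h2 : (i : ℝ) ≤ r := by exact_mod_cast hi
      have h3 : max (1 + (i : ℝ) - α) 0 ≤ max (1 + (r : ℝ) - α) 0 :=
        max_le_max (by linarith) le_rfl
      linarith
    have henv : ∀ i ≤ r, ∀ k ≤ i, ∀ R, max 2 R₁ ≤ R → _ := fun i hi k hk R hR =>
      supersmooth_envelope hα hC₁ k i hk (one_le_two.trans ((le_max_left _ _).trans hR))
        (hlarge i hi R hR)
    obtain ⟨B₁, B₂, hB₁, hB₂, hmain⟩ := exists_measure_supGradError_ge_le d r hd (abs_nonneg D) hK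
      hA (h := fun t => Real.exp (-C₁ * |t| ^ α)) (fun t => (Real.exp_pos _).le)
      fun k hk => (henv k hk k le_rfl _ le_rfl).1
    -- The added `1` makes the required inequality strict.
    refine ⟨B₁ + B₂ * (4 / (C₁ * α)) + 1, max 2 R₁, by positivity,
      one_le_two.trans (le_max_left _ _), ?_⟩
    intro S p₀ hS hdiam hp hr' hsm Ω _ P _ n X i R δ hn hX _ hi hR hδ hδ1 hKn
    have hR2 : 2 ≤ R := (le_max_left _ _).trans hR
    have hR0 : 0 < R := by linarith
    refine (hmain S p₀ hS (hdiam.trans (le_abs_self D)) hp hr' (fun s => ?_) Ω P n X i R δ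
      (4 / (C₁ * α) * (R ^ max (1 + (i : ℝ) - α) 0 * Real.exp (-C₁ * R ^ α))) hn hX hi hR0
      (by positivity) fun k hk => (henv i hi k hk R hR).2).2 hR2 hδ hδ1 hKn _ ?_
    · rw [← Real.exp_sum, ← Finset.mul_sum]
      exact hsm s
    · set q := Real.sqrt (R ^ (d + 2 * i) * Real.log R * Real.log (2 / δ) / n)
      have hq : 0 ≤ q := Real.sqrt_nonneg _
      set y := R ^ max (1 + (i : ℝ) - α) 0 * Real.exp (-C₁ * R ^ α)
      have hy : 0 < y := by positivity
      have h1 : 0 ≤ B₂ * (4 / (C₁ * α)) := by positivity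
      have h2 : (B₁ + B₂ * (4 / (C₁ * α)) + 1) * (y + q) =
          B₁ * q + B₂ * (4 / (C₁ * α) * y) + (B₁ * y + B₂ * (4 / (C₁ * α)) * q + y + q) := by ring
      rw [h2]
      have : 0 < B₁ * y + B₂ * (4 / (C₁ * α)) * q + y + q := by positivity
      linarith
  · have hk : ∀ k ≤ r, (k : ℝ) + 1 < β := fun k hk => by
      have : (k : ℝ) ≤ r := by exact_mod_cast hk
      linarith
    obtain ⟨B₁, B₂, hB₁, hB₂, hmain⟩ := exists_measure_supGradError_ge_le d r hd (abs_nonneg D) hK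
      hA (h := fun t => 1 / (1 + |t| ^ β)) (fun t => by positivity)
      fun k hkr => (ordinarySmooth_envelope k (hk k hkr) le_rfl).1
    have hβr : 0 < β - r - 1 := by linarith
    have hc := inversionConst_pos d
    -- For `R < 2` the deterministic bound on the fluctuation is at most `B₃ * 2 ^ (-β)`, and the
    -- bias rate is at least `2 ^ (-β)`. With this constant the error event is empty.
    set B₃ : ℝ := 2 ^ r * (inversionConst d * 2) * 4 ^ d * 2 ^ β with hB₃
    have hB₃0 : 0 < B₃ := by positivity
    refine ⟨B₁ + B₂ * (2 / (β - r - 1)) + B₃ + 1, by positivity, ?_⟩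
    intro S p₀ hS hdiam hp hr' hsm Ω _ P _ n X i R δ hn hX _ hi hR hδ hδ1 hKn
    have hR0 : 0 < R := by linarith
    set y := R ^ (-β + ((i : ℝ) + 1)) with hy'
    have hy : 0 < y := by positivity
    have hir : (i : ℝ) ≤ r := by exact_mod_cast hi
    obtain ⟨hsub, hprob⟩ := hmain S p₀ hS (hdiam.trans (le_abs_self D)) hp hr' (fun s => hsm s)
      Ω P n X i R δ (2 / (β - r - 1) * y) hn hX hi hR0 (by positivity) fun k hki => by
        have hki' : (k : ℝ) ≤ i := by exact_mod_cast hki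
        refine (ordinarySmooth_envelope k (hk k (hki.trans hi)) hR).2.trans ?_
        calc _ ≤ 2 * (y / (β - r - 1)) := by
              gcongr
              · exact Real.rpow_le_rpow_of_exponent_le hR (by linarith)
              · linarith
          _ = _ := by ring
    set q := Real.sqrt (R ^ (d + 2 * i) * Real.log R * Real.log (2 / δ) / n)
    have hq : 0 ≤ q := Real.sqrt_nonneg _
    have h1 : 0 ≤ B₂ * (2 / (β - r - 1)) := by positivity
    rcases le_or_gt 2 R with hR2 | hR2
    · refine hprob hR2 hδ hδ1 hKn _ ?_
      have h2 : (B₁ + B₂ * (2 / (β - r - 1)) + B₃ + 1) * (y + q) = B₁ * q +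
          B₂ * (2 / (β - r - 1) * y) + (B₁ * y + B₂ * (2 / (β - r - 1)) * q +
            B₃ * y + B₃ * q + y + q) := by ring
      rw [h2]
      have : 0 < B₁ * y + B₂ * (2 / (β - r - 1)) * q + B₃ * y + B₃ * q + y + q := by positivity
      linarith
    · have hempty := hsub (B₃ * y) ((B₁ + B₂ * (2 / (β - r - 1)) + B₃ + 1) * (y + q))
        (by positivity) (by
          have h2 : (B₁ + B₂ * (2 / (β - r - 1)) + B₃ + 1) * (y + q) = B₃ * y +
              B₂ * (2 / (β - r - 1) * y) + (B₁ * y + B₂ * (2 / (β - r - 1)) * q +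
                B₁ * q + B₃ * q + y + q) := by ring
          rw [h2]
          have : 0 < B₁ * y + B₂ * (2 / (β - r - 1)) * q + B₁ * q + B₃ * q + y + q := by positivity
          linarith)
      refine (measure_mono_null hempty ?_).trans_le (zero_le)
      refine (measure_mono_null ?_ measure_empty)
      rintro ω ⟨x, _, u, hu⟩
      refine absurd hu (not_lt.2 ((abs_fluctuation_le hR0.le _ hp u x).trans ?_))
      have hyb : (2 : ℝ) ^ (-β) ≤ y := by
        calc (2 : ℝ) ^ (-β) ≤ R ^ (-β) :=
              Real.rpow_le_rpow_of_nonpos hR0 hR2.le (by linarith [(Nat.cast_nonneg r : (0:ℝ) ≤ r)])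
          _ ≤ y := Real.rpow_le_rpow_of_exponent_le hR
              (by linarith [(Nat.cast_nonneg i : (0:ℝ) ≤ i)])
      calc R ^ i * (inversionConst d * 2) * (2 * R) ^ d
          ≤ 2 ^ r * (inversionConst d * 2) * 4 ^ d := by
            have : R ^ i ≤ 2 ^ r := (pow_le_pow_left₀ hR0.le hR2.le i).trans
              (pow_le_pow_right₀ one_le_two hi)
            gcongr
            linarith
        _ = B₃ * 2 ^ (-β) := by
            rw [hB₃, mul_assoc _ ((2 : ℝ) ^ β), ← Real.rpow_add two_pos]
            simp
        _ ≤ B₃ * y := by gcongr
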